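/- For $n\in\mathbb N$ let $$I_{n,n+1}=\{f\in C([0,1],M_n\otimes M_{n+1}) : f(0)\in M_n\otimes 1,\ f(1)\in 1\otimes M_{n+1}\}$$ be the dimension drop algebra (matrix algebras over $\mathbb C$). Write $\mathbb C^n\otimes\mathbb C^{n+1}=(\mathbb C^n\otimes\mathbb C^n)\oplus\mathbb C^n$, let $F$ be the self-adjoint unitary that flips the tensor factors of $\mathbb C^n\otimes\mathbb C^n$ and is the identity on the second summand, and for $t\in[0,1]$ put $u_t=\frac{1+e^{i\pi t}}2\,1+\frac{1-e^{i\pi t}}2\,F$, a path of unitaries from $1$ to $F$. Regard $M_n$ as embedded in $I_{n,n+1}$ by the completely positive contractive order zero map $$\iota\colon M_n\to I_{n,n+1},\qquad \iota(x)(t)=u_t^*\bigl(x\otimes\operatorname{diag}(1,\dots,1,1-t)\bigr)u_t ,$$ and for a unit vector $h\in\mathbb C^n$ let $s_h\in I_{n,n+1}$ be $s_h(t)=\sqrt t\;u_t^*\bigl(\sum_{i=1}^n h e_i^*\otimes e_i e_{n+1}^*\bigr)u_t$, where $(e_i)$ are the standard basis vectors. **Theorem.** Let $G$ be a finite group, let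 $B$ be a unital $C^*$-algebra and let $\beta\colon G\to\operatorname{Aut}(B)$ be an action. Let $n\in\mathbb N$, let $v\colon G\to U(n)$ be a unitary representation containing the trivial representation, and let $e_{1,1}\in M_n$ be a rank-one projection onto a line of $v$-fixed vectors, that is, $v_g e_{1,1}=e_{1,1}$ for all $g\in G$. Suppose that $\xi\colon (M_n,\operatorname{Ad}(v))\to(B,\beta)$ is a completely positive contractive equivariant map of order zero (that is, $\xi(a)\xi(b)=0$ whenever $a,b\ge 0$ and $ab=0$), and that $s\in B$ is a contraction fixed by $\beta$ with $\xi(e_{1,1})s=s$ and $\xi(1)+s^*s=1$. Let $\gamma$ be the restriction to $I_{n,n+1}$ of the action $\mathrm{id}_{C([0,1])}\otimes\operatorname{Ad}(v)\otimes\operatorname{Ad}(v\oplus 1_{\mathbb C})$ of $G$ on $C([0,1])\otimes M_n\otimes M_{n+1}$. Then $\xi$ extends to a unital equivariant homomorphism $\pi\colon(I_{n,n+1},\gamma)\to(B,\beta)$, that is, $\pi\circ\iota=\xi$; moreover, $\pi$ can be chosen so that $\pi(s_h)=s$ for some unit vector $h$ with $e_{1,1}=hh^*$. -/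

import Mathlib

/-!
An order zero map `ξ` satisfies `ξ(a) ξ(b) = ξ(1) ξ(ab)`. Hence, if `e₁₁ = h h^*`, the elements
`ξ(eₖ h^*) s` for `k ≤ n`, completed by `|s| = √(1 - ξ(1))`, form together with `ξ` a system
satisfying the same finitely many relations as the generators of `I_{n,n+1}`. These relations bring
every element of the generated `*`-algebra into the form `ξ(a) + H(b) + ∑ q_{αβ}(z) W_{αβ}`, with
`z` a central positive contraction and `W_{αβ} W_{βγ} = z (1 - z) W_{αγ}`.

In `I_{n,n+1}`, conjugation by `u_t` turns this element into an explicit matrix path with end points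
determined by `a` and `b` and with interior part `t (1 - t) q_{αβ}(t)`. By Bernstein approximation
such paths are dense, and the norm of the path controls `a`, `b` and the functions
`t (1 - t) q_{αβ}(t)`, which in turn control the norm of the element of `B` with the same
coefficients. So the correspondence of normal forms extends to a homomorphism `I_{n,n+1} → B`.

A homomorphism on `I_{n,n+1}` is determined by its values on the image of `M_n` and on `s_h`,
because `|s_h| = √(1 - ι(1))` supplies the missing generator. Conjugating by the actions leaves
these values unchanged, whence equivariance.
-/

open scoped ComplexOrder

namespace DimDrop

/-- The C*-algebra of complex square matrices with rows and columns indexed by `ι`, with the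
operator norm and its C*-algebraic order. For `ι = Fin n` this is `M_n`. -/
abbrev Mat (ι : Type*) := CStarMatrix ι ι ℂ

section Matrices


variable {ι κ : Type*} [Fintype ι] [DecidableEq ι] [Fintype κ] [DecidableEq κ]

/-- The elementary tensor `a ⊗ b` in `M_ι ⊗ M_κ = M_{ι × κ}` (Kronecker product). -/
def kron (a : Mat ι) (b : Mat κ) : Mat (ι × κ) :=
  CStarMatrix.ofMatrix
    (Matrix.kronecker (CStarMatrix.ofMatrix.symm a) (CStarMatrix.ofMatrix.symm b))

/-- The block diagonal matrix `a ⊕ b`. -/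
def directSum (a : Mat ι) (b : Mat κ) : Mat (ι ⊕ κ) :=
  CStarMatrix.ofMatrix
    (Matrix.fromBlocks (CStarMatrix.ofMatrix.symm a) 0 0 (CStarMatrix.ofMatrix.symm b))

theorem kron_apply (a : Mat ι) (b : Mat κ) (p q : ι × κ) :
    kron a b p q = a p.1 q.1 * b p.2 q.2 := rfl

theorem kron_mul (a a' : Mat ι) (b b' : Mat κ) :
    kron a b * kron a' b' = kron (a * a') (b * b') :=
  (Matrix.mul_kronecker_mul (CStarMatrix.ofMatrix.symm a) (CStarMatrix.ofMatrix.symm a')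
    (CStarMatrix.ofMatrix.symm b) (CStarMatrix.ofMatrix.symm b')).symm

theorem kron_one : kron (1 : Mat ι) (1 : Mat κ) = 1 :=
  Matrix.one_kronecker_one

theorem kron_star (a : Mat ι) (b : Mat κ) : star (kron a b) = kron (star a) (star b) := by
  ext p q
  simp [kron_apply, CStarMatrix.star_apply]

theorem kron_add_left (a a' : Mat ι) (b : Mat κ) :
    kron (a + a') b = kron a b + kron a' b := by
  ext p q
  simp [kron_apply, CStarMatrix.add_apply, add_mul]

theorem kron_add_right (a : Mat ι) (b b' : Mat κ) :
    kron a (b + b') = kron a b + kron a b' := by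
  ext p q
  simp [kron_apply, CStarMatrix.add_apply, mul_add]

theorem kron_smul_left (c : ℂ) (a : Mat ι) (b : Mat κ) : kron (c • a) b = c • kron a b := by
  ext p q
  simp [kron_apply, CStarMatrix.smul_apply, mul_assoc]

theorem kron_smul_right (c : ℂ) (a : Mat ι) (b : Mat κ) : kron a (c • b) = c • kron a b := by
  ext p q
  simp [kron_apply, CStarMatrix.smul_apply, mul_left_comm]

theorem directSum_mul (a a' : Mat ι) (b b' : Mat κ) :
    directSum a b * directSum a' b' = directSum (a * a') (b * b') := by
  refine (Matrix.fromBlocks_multiply _ _ _ _ _ _ _ _).trans ?_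
  simp only [Matrix.mul_zero, Matrix.zero_mul, add_zero, zero_add]
  rfl

theorem directSum_one : directSum (1 : Mat ι) (1 : Mat κ) = 1 :=
  Matrix.fromBlocks_one

theorem directSum_star (a : Mat ι) (b : Mat κ) :
    star (directSum a b) = directSum (star a) (star b) := by
  refine (Matrix.fromBlocks_conjTranspose _ _ _ _).trans ?_
  simp only [Matrix.conjTranspose_zero]
  rfl

end Matrices

section Algebra

variable (ι κ : Type*) [Fintype ι] [DecidableEq ι] [Fintype κ] [DecidableEq κ]

/-- The dimension drop algebra
`{f ∈ C([0,1], M_ι ⊗ M_κ) : f(0) ∈ M_ι ⊗ 1, f(1) ∈ 1 ⊗ M_κ}`.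
For index sets with `m` and `n` elements this is `I_{m,n}`. -/
def dimDrop : StarSubalgebra ℂ C(unitInterval, Mat (ι × κ)) where
  carrier := {f | (∃ a : Mat ι, f 0 = kron a 1) ∧ ∃ b : Mat κ, f 1 = kron 1 b}
  mul_mem' := by
    rintro f g ⟨⟨a, ha⟩, b, hb⟩ ⟨⟨a', ha'⟩, b', hb'⟩
    exact ⟨⟨a * a', by rw [ContinuousMap.mul_apply, ha, ha', kron_mul, mul_one]⟩,
      b * b', by rw [ContinuousMap.mul_apply, hb, hb', kron_mul, mul_one]⟩
  add_mem' := by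
    rintro f g ⟨⟨a, ha⟩, b, hb⟩ ⟨⟨a', ha'⟩, b', hb'⟩
    exact ⟨⟨a + a', by rw [ContinuousMap.add_apply, ha, ha', kron_add_left]⟩,
      b + b', by rw [ContinuousMap.add_apply, hb, hb', kron_add_right]⟩
  algebraMap_mem' := by
    intro r
    refine ⟨⟨r • 1, ?_⟩, r • 1, ?_⟩
    · rw [kron_smul_left, kron_one, Algebra.algebraMap_eq_smul_one]; rfl
    · rw [kron_smul_right, kron_one, Algebra.algebraMap_eq_smul_one]; rfl
  star_mem' := by
    rintro f ⟨⟨a, ha⟩, b, hb⟩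
    exact ⟨⟨star a, by rw [ContinuousMap.star_apply, ha, kron_star, star_one]⟩,
      star b, by rw [ContinuousMap.star_apply, hb, kron_star, star_one]⟩

end Algebra

section Actions

variable {ι κ : Type*} [Fintype ι] [DecidableEq ι] [Fintype κ] [DecidableEq κ]
variable {G : Type*} [Group G]

/-- The direct sum `v ⊕ w` of two unitary representations. -/
def sumRep (v : G →* unitary (Mat ι)) (w : G →* unitary (Mat κ)) :
    G →* unitary (Mat (ι ⊕ κ)) where
  toFun g := ⟨directSum (v g : Mat ι) (w g : Mat κ), by
    rw [Unitary.mem_iff, directSum_star, directSum_mul, directSum_mul]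
    simp [directSum_one]⟩
  map_one' := Subtype.ext (by simp [directSum_one])
  map_mul' g h := Subtype.ext (by simp [directSum_mul])

/-- The tensor product `v ⊗ w` of two unitary representations. -/
def tensorRep (v : G →* unitary (Mat ι)) (w : G →* unitary (Mat κ)) :
    G →* unitary (Mat (ι × κ)) where
  toFun g := ⟨kron (v g : Mat ι) (w g : Mat κ), by
    rw [Unitary.mem_iff, kron_star, kron_mul, kron_mul]
    simp [kron_one]⟩
  map_one' := Subtype.ext (by simp [kron_one])
  map_mul' g h := Subtype.ext (by simp [kron_mul])

/-- The action `Ad v` of `G` on a matrix algebra: `Ad(v)_g (x) = v_g x v_g^*`. -/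
noncomputable def Ad (v : G →* unitary (Mat ι)) : G →* (Mat ι ≃⋆ₐ[ℂ] Mat ι) :=
  (Unitary.conjStarAlgAut ℂ (Mat ι)).comp v

theorem Ad_apply (v : G →* unitary (Mat ι)) (g : G) (x : Mat ι) :
    Ad v g x = (v g : Mat ι) * x * star (v g : Mat ι) := rfl

/-- `Ad(v ⊗ w) = Ad(v) ⊗ Ad(w)`. -/
theorem Ad_tensorRep (v : G →* unitary (Mat ι)) (w : G →* unitary (Mat κ)) (g : G)
    (a : Mat ι) (b : Mat κ) :
    Ad (tensorRep v w) g (kron a b) = kron (Ad v g a) (Ad w g b) := by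
  simp only [Ad_apply, tensorRep, MonoidHom.coe_mk, OneHom.coe_mk, kron_star, kron_mul]

/-- The pointwise action of `Ad(v) ⊗ Ad(w)` on the dimension drop algebra. -/
noncomputable def dimDropHom (v : G →* unitary (Mat ι)) (w : G →* unitary (Mat κ)) (g : G)
    (f : dimDrop ι κ) : dimDrop ι κ :=
  ⟨⟨fun t => Ad (tensorRep v w) g ((f : C(unitInterval, Mat (ι × κ))) t), by
      simp only [Ad_apply]
      fun_prop⟩, by
    obtain ⟨f, ⟨a, ha⟩, b, hb⟩ := f
    refine ⟨⟨Ad v g a, ?_⟩, Ad w g b, ?_⟩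
    · rw [ContinuousMap.coe_mk, ha, Ad_tensorRep, map_one]
    · rw [ContinuousMap.coe_mk, hb, Ad_tensorRep, map_one]⟩

theorem dimDropHom_apply (v : G →* unitary (Mat ι)) (w : G →* unitary (Mat κ)) (g : G)
    (f : dimDrop ι κ) (t : unitInterval) :
    (dimDropHom v w g f : C(unitInterval, Mat (ι × κ))) t =
      Ad (tensorRep v w) g ((f : C(unitInterval, Mat (ι × κ))) t) := rfl

/-- The action `γ_{v,w}` of `G` on the dimension drop algebra: the restriction of
`id ⊗ Ad(v) ⊗ Ad(w)` on `C([0,1]) ⊗ M_ι ⊗ M_κ`. -/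
noncomputable def dimDropAction (v : G →* unitary (Mat ι)) (w : G →* unitary (Mat κ)) :
    G →* (dimDrop ι κ ≃⋆ₐ[ℂ] dimDrop ι κ) where
  toFun g :=
    { toFun := dimDropHom v w g
      invFun := dimDropHom v w g⁻¹
      left_inv := fun f => by
        refine Subtype.ext (ContinuousMap.ext fun t => ?_)
        rw [dimDropHom_apply, dimDropHom_apply, ← StarAlgEquiv.mul_apply, ← map_mul]
        simp
      right_inv := fun f => by
        refine Subtype.ext (ContinuousMap.ext fun t => ?_)
        rw [dimDropHom_apply, dimDropHom_apply, ← StarAlgEquiv.mul_apply, ← map_mul]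
        simp
      map_mul' := fun f f' => Subtype.ext (ContinuousMap.ext fun t =>
        map_mul (Ad (tensorRep v w) g) ((f : C(unitInterval, Mat (ι × κ))) t)
          ((f' : C(unitInterval, Mat (ι × κ))) t))
      map_add' := fun f f' => Subtype.ext (ContinuousMap.ext fun t =>
        map_add (Ad (tensorRep v w) g) ((f : C(unitInterval, Mat (ι × κ))) t)
          ((f' : C(unitInterval, Mat (ι × κ))) t))
      map_star' := fun f => Subtype.ext (ContinuousMap.ext fun t =>
        map_star (Ad (tensorRep v w) g) ((f : C(unitInterval, Mat (ι × κ))) t))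
      map_smul' := fun c f => Subtype.ext (ContinuousMap.ext fun t =>
        map_smul (Ad (tensorRep v w) g) c ((f : C(unitInterval, Mat (ι × κ))) t)) }
  map_one' := by
    refine StarAlgEquiv.ext fun f => Subtype.ext (ContinuousMap.ext fun t => ?_)
    change Ad (tensorRep v w) 1 _ = _
    rw [map_one]; rfl
  map_mul' g h := by
    refine StarAlgEquiv.ext fun f => Subtype.ext (ContinuousMap.ext fun t => ?_)
    change Ad (tensorRep v w) (g * h) _ = _
    rw [map_mul]; rfl

end Actions

section Embedding

variable (n : ℕ)

/-- An index set with `n + 1` elements, split as `n + 1`; `Mat (Succ n)` is `M_{n+1}`. -/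
abbrev Succ (n : ℕ) := Fin n ⊕ Fin 1

/-- The rank-one projection `0 ⊕ 1` in `M_{n+1}` onto the last coordinate. -/
def lastProj : Mat (Succ n) := directSum 0 1

/-- The partial tensor flip on `ℂ^n ⊗ (ℂ^n ⊕ ℂ) = (ℂ^n ⊗ ℂ^n) ⊕ ℂ^n`: the self-adjoint unitary
that maps `e_i ⊗ e_j` to `e_j ⊗ e_i` for `i, j ≤ n` and fixes `e_i ⊗ e_{n+1}`. -/
def flip : Mat (Fin n × Succ n) := fun p q =>
  match p, q with
  | (i, Sum.inl j), (k, Sum.inl l) => if i = l ∧ j = k then 1 else 0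
  | (i, Sum.inr _), (k, Sum.inr _) => if i = k then 1 else 0
  | _, _ => 0

/-- The unitary path `u_t = (1 + e^{iπt})/2 + (1 - e^{iπt})/2 · flip`, from `u_0 = 1` to
`u_1 = flip`. It commutes with `w ⊗ (w ⊕ 1)` for every unitary `w` of `M_n`. -/
noncomputable def flipPath (t : unitInterval) : Mat (Fin n × Succ n) :=
  ((1 + Complex.exp (Real.pi * (t : ℝ) * Complex.I)) / 2) • (1 : Mat (Fin n × Succ n)) +
    ((1 - Complex.exp (Real.pi * (t : ℝ) * Complex.I)) / 2) • flip n

theorem flipPath_zero : flipPath n 0 = 1 := by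
  simp [flipPath]

theorem flipPath_one : flipPath n 1 = flip n := by
  simp [flipPath]

theorem continuous_flipPath : Continuous (flipPath n) := by
  unfold flipPath
  fun_prop

theorem flip_star : star (flip n) = flip n := by
  ext ⟨i, j⟩ ⟨k, l⟩
  rw [CStarMatrix.star_apply]
  rcases j with j | j <;> rcases l with l | l <;> simp [flip, and_comm, eq_comm]

variable {n}

theorem flip_mul (A : Mat (Fin n × Succ n)) (i : Fin n) (j : Succ n) (q : Fin n × Succ n) :
    (flip n * A) (i, j) q = A (Sum.elim (fun k => (k, Sum.inl i)) (fun k => (i, Sum.inr k)) j) q := by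
  rw [CStarMatrix.mul_apply]
  rcases j with j | j
  · rw [Finset.sum_eq_single (j, Sum.inl i)]
    · simp [flip]
    · rintro ⟨k, l⟩ - h
      rcases l with l | l
      · have : ¬ (i = l ∧ j = k) := by rintro ⟨rfl, rfl⟩; exact h rfl
        simp [flip, this]
      · simp [flip]
    · simp
  · rw [Finset.sum_eq_single (i, Sum.inr j)]
    · simp [flip]
    · rintro ⟨k, l⟩ - h
      rcases l with l | l
      · simp [flip]
      · have : ¬ (i = k) := by
          rintro rfl; exact h (by rw [Subsingleton.elim l j])
        simp [flip, this]
    · simp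

theorem mul_flip (A : Mat (Fin n × Succ n)) (i : Fin n) (j : Succ n) (q : Fin n × Succ n) :
    (A * flip n) q (i, j) = A q (Sum.elim (fun k => (k, Sum.inl i)) (fun k => (i, Sum.inr k)) j) := by
  have h := flip_mul (star A) i j q
  rw [← flip_star, ← star_mul, CStarMatrix.star_apply, CStarMatrix.star_apply] at h
  exact star_injective h

/-- The canonical completely positive contractive order zero embedding of `M_n` into `I_{n,n+1}`,
`x ↦ (t ↦ u_t^* (x ⊗ diag(1, …, 1, 1 - t)) u_t)`; it takes the value `x ⊗ 1` at `t = 0` and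
`1 ⊗ (x ⊕ 0)` at `t = 1`. -/
noncomputable def embed (x : Mat (Fin n)) : dimDrop (Fin n) (Succ n) :=
  ⟨⟨fun t => star (flipPath n t) * kron x (1 - ((t : ℝ) : ℂ) • lastProj n) * flipPath n t, by
      have h := continuous_flipPath n
      simp only [sub_eq_add_neg, ← neg_smul, kron_add_right, kron_smul_right]
      fun_prop⟩, by
    refine ⟨⟨x, ?_⟩, directSum x 0, ?_⟩
    · rw [ContinuousMap.coe_mk, flipPath_zero, star_one, one_mul, mul_one, Set.Icc.coe_zero,
        Complex.ofReal_zero, zero_smul ℂ, sub_zero]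
    · rw [ContinuousMap.coe_mk, flipPath_one, flip_star]
      ext ⟨i, j⟩ ⟨k, l⟩
      rw [mul_flip, flip_mul]
      rcases j with j | j <;> rcases l with l | l <;>
        simp [kron_apply, lastProj, directSum, CStarMatrix.one_apply, CStarMatrix.sub_apply,
          mul_comm, Subsingleton.elim _ (0 : Fin 1)]⟩

/-- For `h ∈ ℂ^n`, the matrix `∑_i (h e_i^*) ⊗ (e_i e_{n+1}^*)` in `M_n ⊗ M_{n+1}`. -/
def cornerMat (h : Fin n → ℂ) : Mat (Fin n × Succ n) := fun p q =>
  match p, q with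
  | (i, Sum.inl j), (k, Sum.inr _) => if j = k then h i else 0
  | _, _ => 0

/-- The matrix `h e_{n+1}^*` in `M_{n+1}`. -/
def lastCol (h : Fin n → ℂ) : Mat (Succ n) := fun p q =>
  match p, q with
  | Sum.inl i, Sum.inr _ => h i
  | _, _ => 0

/-- The canonical element `t ↦ √t · u_t^* (∑_i (h e_i^*) ⊗ (e_i e_{n+1}^*)) u_t` of `I_{n,n+1}`;
it takes the value `0` at `t = 0` and `1 ⊗ (h e_{n+1}^*)` at `t = 1`. -/
noncomputable def corner (h : Fin n → ℂ) : dimDrop (Fin n) (Succ n) :=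
  ⟨⟨fun t => ((Real.sqrt (t : ℝ) : ℝ) : ℂ) •
      (star (flipPath n t) * cornerMat h * flipPath n t), by
      have h := continuous_flipPath n
      fun_prop⟩, by
    refine ⟨⟨0, ?_⟩, lastCol h, ?_⟩
    · rw [ContinuousMap.coe_mk, Set.Icc.coe_zero, Real.sqrt_zero, Complex.ofReal_zero,
        zero_smul ℂ]
      ext p q
      simp [kron_apply]
    · rw [ContinuousMap.coe_mk, flipPath_one, flip_star]
      ext ⟨i, j⟩ ⟨k, l⟩
      rw [CStarMatrix.smul_apply, mul_flip, flip_mul]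
      rcases j with j | j <;> rcases l with l | l <;>
        simp [kron_apply, cornerMat, lastCol, CStarMatrix.one_apply]⟩

end Embedding

/-- A map between ordered algebras has *order zero* if it sends orthogonal positive elements to
orthogonal elements. -/
def IsOrderZero {A B : Type*} [Mul A] [Zero A] [Preorder A] [Mul B] [Zero B] (φ : A → B) : Prop :=
  ∀ a b : A, 0 ≤ a → 0 ≤ b → a * b = 0 → φ a * φ b = 0

end DimDrop

namespace DimDrop

open Polynomial
open scoped Matrix

section OrderZero

variable {A B : Type*} [CStarAlgebra A] [PartialOrder A] [StarOrderedRing A]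
  [CStarAlgebra B] [PartialOrder B] [StarOrderedRing B]

-- The real structure of `CStarMatrix` hides its functional calculus from instance search, so
-- these two Mathlib facts cannot be applied to matrices directly.
theorem exists_eq_star_mul_self {D : Type*} [NonUnitalCStarAlgebra D] [PartialOrder D]
    [StarOrderedRing D] {a : D} (ha : 0 ≤ a) : ∃ b, a = star b * b :=
  CStarAlgebra.nonneg_iff_eq_star_mul_self.mp ha

theorem completelyPositiveMap_star (ξ : CompletelyPositiveMap A B) (a : A) :
    ξ (star a) = star (ξ a) := map_star ξ a

theorem entry_mul_eq_zero_of_nonneg {k : Type*} [Fintype k] {N : CStarMatrix k k B} (hN : 0 ≤ N)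
    {i : k} {y : B} (h : N i i * y = 0) (j : k) : N j i * y = 0 := by
  classical
  obtain ⟨S, rfl⟩ := exists_eq_star_mul_self hN
  have column_sum : ∑ l, star (S l i * y) * (S l i * y) = 0 := by
    simpa [CStarMatrix.mul_apply, CStarMatrix.star_apply, Finset.sum_mul, Finset.mul_sum,
      mul_assoc] using congrArg (star y * ·) h
  have column_eq_zero (l : k) : S l i * y = 0 := by
    rw [Finset.sum_eq_zero_iff_of_nonneg fun l _ => star_mul_self_nonneg _] at column_sum
    exact CStarRing.star_mul_self_eq_zero_iff _ |>.mp (column_sum l (Finset.mem_univ l))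
  simp [CStarMatrix.mul_apply, Finset.sum_mul, mul_assoc, column_eq_zero]

theorem map_star_mul_mul_eq_zero (ξ : CompletelyPositiveMap A B) {a : A} {y : B}
    (h : ξ (star a * a) * y = 0) (b : A) : ξ (star b * a) * y = 0 := by
  let R : CStarMatrix (Fin 2) (Fin 2) A := CStarMatrix.ofMatrix !![a, b; 0, 0]
  have map_nonneg : 0 ≤ (star R * R).map ξ :=
    ξ.map_cstarMatrix_nonneg' 2 _ (star_mul_self_nonneg R)
  have map_apply (i j : Fin 2) : (star R * R).map ξ i j = ξ (star (R 0 i) * R 0 j) := by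
    have : R 1 i = 0 := by fin_cases i <;> rfl
    simp [CStarMatrix.mul_apply, CStarMatrix.star_apply, Fin.sum_univ_two, this]
  have := entry_mul_eq_zero_of_nonneg map_nonneg (i := 0) ((map_apply 0 0).symm ▸ h) 1
  rwa [map_apply] at this

namespace IsOrderZero

variable {ξ : CompletelyPositiveMap A B}

theorem map_mul_map_eq_zero (hξ : IsOrderZero ξ) {p q : A} (hp : IsStarProjection p)
    (hq : IsStarProjection q) (hpq : p * q = 0) (a b : A) : ξ (a * p) * ξ (q * b) = 0 := by
  have hq_sq : star q * q = q := by rw [hq.isSelfAdjoint.star_eq, hq.isIdempotentElem]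
  have hp_sq : star p * p = p := by rw [hp.isSelfAdjoint.star_eq, hp.isIdempotentElem]
  have hqp : ξ q * ξ p = 0 := by
    refine hξ q p hq.nonneg hp.nonneg ?_
    simpa [hp.isSelfAdjoint.star_eq, hq.isSelfAdjoint.star_eq] using congrArg star hpq
  have hbqp : ξ (star b * q) * ξ p = 0 := map_star_mul_mul_eq_zero ξ (by rwa [hq_sq]) b
  have hpqb : ξ p * ξ (q * b) = 0 := by
    simpa [← map_star, hp.isSelfAdjoint.star_eq, hq.isSelfAdjoint.star_eq] using
      congrArg star hbqp
  simpa using map_star_mul_mul_eq_zero ξ (a := p) (by rwa [hp_sq]) (star a)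

theorem map_mul_proj_mul_map (hξ : IsOrderZero ξ) {p : A} (hp : IsStarProjection p) (a b : A) :
    ξ (a * p) * ξ b = ξ a * ξ (p * b) := by
  have left : ξ (a * p) * ξ ((1 - p) * b) = 0 :=
    hξ.map_mul_map_eq_zero hp hp.one_sub (by rw [mul_sub, mul_one, hp.isIdempotentElem, sub_self])
      a b
  have right : ξ (a * (1 - p)) * ξ (p * b) = 0 :=
    hξ.map_mul_map_eq_zero hp.one_sub hp (by rw [sub_mul, one_mul, hp.isIdempotentElem, sub_self])
      a b
  rw [sub_mul, one_mul, map_sub, mul_sub, sub_eq_zero] at left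
  rw [mul_sub, mul_one, map_sub, sub_mul, sub_eq_zero] at right
  rw [left, right]

end IsOrderZero

/-- The elements `x` that may be moved across the product `ξ(a) ξ(b)`. For a completely positive
order zero map they exhaust the domain, which amounts to `ξ(a) ξ(b) = ξ(1) ξ(a b)`. -/
def balancedSubalgebra (ξ : CompletelyPositiveMap A B) : Subalgebra ℂ A where
  carrier := {x | ∀ a b, ξ (a * x) * ξ b = ξ a * ξ (x * b)}
  mul_mem' := by
    intro x y hx hy a b
    rw [← mul_assoc, hy, hx, mul_assoc]
  add_mem' := by
    intro x y hx hy a b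
    rw [mul_add, add_mul, map_add, map_add, add_mul, mul_add, hx, hy]
  algebraMap_mem' := by
    intro r a b
    rw [← Algebra.commutes, ← Algebra.smul_def, ← Algebra.smul_def, map_smul, map_smul,
      smul_mul_assoc, mul_smul_comm]

end OrderZero

section MatrixUnits

variable {ι : Type*} [DecidableEq ι]

/-- The matrix unit `e_{ij}` of `Mat ι`. -/
def matrixUnit (i j : ι) : Mat ι := CStarMatrix.ofMatrix (Matrix.single i j 1)

theorem matrixUnit_apply (i j k l : ι) :
    matrixUnit i j k l = if i = k ∧ j = l then 1 else 0 := rfl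

theorem star_matrixUnit (i j : ι) : star (matrixUnit i j) = matrixUnit j i :=
  (Matrix.conjTranspose_single i j (1 : ℂ)).trans (by rw [star_one]; rfl)

variable [Fintype ι]

theorem eq_sum_matrixUnit (a : Mat ι) : a = ∑ i, ∑ j, a i j • matrixUnit i j := by
  refine (Matrix.matrix_eq_sum_single (CStarMatrix.ofMatrix.symm a)).trans ?_
  refine Finset.sum_congr rfl fun i _ => Finset.sum_congr rfl fun j _ => ?_
  have h := Matrix.smul_single (a i j) i j (1 : ℂ)
  rw [smul_eq_mul, mul_one] at h
  exact h.symm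

theorem matrixUnit_mul_matrixUnit (i j k l : ι) :
    matrixUnit i j * matrixUnit k l = if j = k then matrixUnit i l else 0 := by
  split_ifs with h
  · subst h
    exact (Matrix.single_mul_single_same (1 : ℂ) i j l 1).trans (by rw [mul_one]; rfl)
  · exact Matrix.single_mul_single_of_ne (1 : ℂ) i j k h 1

theorem isStarProjection_matrixUnit (i : ι) : IsStarProjection (matrixUnit i i) :=
  ⟨isIdempotentElem_iff.mpr ((matrixUnit_mul_matrixUnit i i i i).trans (if_pos rfl)),
    star_matrixUnit i i⟩

theorem isStarProjection_half_smul_add_matrixUnit {i j : ι} (hij : i ≠ j) :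
    IsStarProjection ((1 / 2 : ℂ) •
      (matrixUnit i i + matrixUnit j j + matrixUnit i j + matrixUnit j i)) where
  isIdempotentElem := by
    simp only [isIdempotentElem_iff, smul_mul_smul_comm, add_mul, mul_add,
      matrixUnit_mul_matrixUnit, hij, hij.symm, if_true, if_false]
    module
  isSelfAdjoint := by
    simp only [isSelfAdjoint_iff, star_smul, star_add, star_matrixUnit]
    rw [show star (1 / 2 : ℂ) = 1 / 2 by simp]
    module

variable {B : Type*} [CStarAlgebra B] [PartialOrder B] [StarOrderedRing B]
  {ξ : CompletelyPositiveMap (Mat ι) B}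

theorem IsOrderZero.matrixUnit_mem_balancedSubalgebra (hξ : IsOrderZero ξ) (i j : ι) :
    matrixUnit i j ∈ balancedSubalgebra ξ := by
  have proj_mem {p : Mat ι} (hp : IsStarProjection p) : p ∈ balancedSubalgebra ξ :=
    hξ.map_mul_proj_mul_map hp
  obtain rfl | hij := eq_or_ne i j
  · exact proj_mem (isStarProjection_matrixUnit i)
  have compression : matrixUnit i j = (2 : ℂ) • (matrixUnit i i * ((1 / 2 : ℂ) •
      (matrixUnit i i + matrixUnit j j + matrixUnit i j + matrixUnit j i)) * matrixUnit j j) := by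
    simp only [mul_smul_comm, smul_mul_assoc, mul_add, add_mul, matrixUnit_mul_matrixUnit, hij,
      if_true, if_false, zero_mul]
    module
  rw [compression]
  exact Subalgebra.smul_mem _ (mul_mem (mul_mem (proj_mem (isStarProjection_matrixUnit i))
    (proj_mem (isStarProjection_half_smul_add_matrixUnit hij)))
    (proj_mem (isStarProjection_matrixUnit j))) 2

theorem IsOrderZero.map_mul_map (hξ : IsOrderZero ξ) (a b : Mat ι) :
    ξ a * ξ b = ξ 1 * ξ (a * b) := by
  have ha : a ∈ balancedSubalgebra ξ := by
    rw [eq_sum_matrixUnit a]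
    exact sum_mem fun i _ => sum_mem fun j _ =>
      Subalgebra.smul_mem _ (hξ.matrixUnit_mem_balancedSubalgebra i j) _
  simpa using ha 1 b

end MatrixUnits

section RankOne

variable {ι : Type*}

/-- The matrix `x y^*`. -/
def rankOne (x y : ι → ℂ) : Mat ι := fun i j => x i * star (y j)

theorem rankOne_apply (x y : ι → ℂ) (i j : ι) : rankOne x y i j = x i * star (y j) := rfl

theorem rankOne_left_injective {y : ι → ℂ} (hy : y ≠ 0) :
    Function.Injective (rankOne · y) := by
  obtain ⟨j, hj⟩ := Function.ne_iff.mp hy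
  exact fun x x' h => funext fun i =>
    mul_right_cancel₀ (star_ne_zero.mpr hj) (congrFun (congrFun h i) j)

theorem star_rankOne (x y : ι → ℂ) : star (rankOne x y) = rankOne y x := by
  ext i j
  simp [CStarMatrix.star_apply, rankOne_apply, mul_comm]

variable [Fintype ι]

theorem mul_rankOne (a : Mat ι) (x y : ι → ℂ) :
    a * rankOne x y = rankOne (fun i => ∑ j, a i j * x j) y := by
  ext i j
  simp [CStarMatrix.mul_apply, rankOne_apply, Finset.sum_mul, mul_assoc]

theorem rankOne_mul_rankOne (x y x' y' : ι → ℂ) :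
    rankOne x y * rankOne x' y' = (star y ⬝ᵥ x') • rankOne x y' := by
  ext i j
  simp only [CStarMatrix.mul_apply, CStarMatrix.smul_apply, rankOne_apply, dotProduct,
    Pi.star_apply, smul_eq_mul, Finset.sum_mul]
  exact Finset.sum_congr rfl fun k _ => by ring

theorem isIdempotentElem_rankOne_self {h : ι → ℂ} (hh : star h ⬝ᵥ h = 1) :
    IsIdempotentElem (rankOne h h) := by
  rw [IsIdempotentElem, rankOne_mul_rankOne, hh, one_smul]

theorem rankOne_eq_sum_single [DecidableEq ι] (x y : ι → ℂ) :
    rankOne x y = ∑ i, x i • rankOne (Pi.single i 1) y := by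
  ext k l
  refine Eq.trans ?_ (Matrix.sum_apply k l Finset.univ
    fun i => CStarMatrix.ofMatrix.symm (x i • rankOne (Pi.single i 1) y)).symm
  change _ = ∑ i, x i • ((Pi.single i 1 : ι → ℂ) k * star (y l))
  simp [rankOne_apply, Pi.single_apply]

theorem exists_apply_eq_mul_of_rank_eq_one {R m : Type*} [Field R] {M : Matrix m ι R}
    (hM : M.rank = 1) : ∃ (x : m → R) (y : ι → R), ∀ i j, M i j = x i * y j := by
  classical
  obtain ⟨⟨x, _⟩, -, span_x⟩ := finrank_eq_one_iff'.mp hM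
  choose y hy using fun j => span_x ⟨_, LinearMap.mem_range_self _ (Pi.single j 1)⟩
  refine ⟨x, y, fun i j => ?_⟩
  have := congrFun (congrArg Subtype.val (hy j)) i
  simp only [Matrix.mulVecLin_apply, Matrix.mulVec_single_one] at this
  exact this.symm.trans (mul_comm _ _)

theorem exists_eq_rankOne_self {e : Mat ι} (he : IsStarProjection e)
    (he_rank : (CStarMatrix.ofMatrix.symm e).rank = 1) :
    ∃ h : ι → ℂ, star h ⬝ᵥ h = 1 ∧ e = rankOne h h := by
  obtain ⟨x, y, hxy⟩ := exists_apply_eq_mul_of_rank_eq_one he_rank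
  obtain ⟨r, hr⟩ : ∃ r : ℂ, r * star r = ∑ k, y k * star (y k) := by
    refine ⟨(√(∑ k, ‖y k‖ ^ 2) : ℝ), ?_⟩
    rw [Complex.star_def, Complex.conj_ofReal, ← Complex.ofReal_mul,
      Real.mul_self_sqrt (by positivity)]
    simp [Complex.mul_conj']
  have e_eq : e = rankOne (r • x) (r • x) := by
    conv_lhs => rw [← he.isIdempotentElem.eq]
    nth_rw 2 [← he.isSelfAdjoint.star_eq]
    ext i j
    calc _ = ∑ k, x i * y k * star (x j * y k) := by
          simp only [← hxy]
          exact CStarMatrix.mul_apply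
      _ = (∑ k, y k * star (y k)) * (x i * star (x j)) := by
          rw [Finset.sum_mul]
          exact Finset.sum_congr rfl fun k _ => by rw [star_mul]; ring
      _ = _ := by
          rw [← hr, rankOne_apply, Pi.smul_apply, Pi.smul_apply, smul_eq_mul, smul_eq_mul, star_mul]
          ring
  have e_ne_zero : e ≠ 0 := by
    rintro rfl
    exact zero_ne_one ((Matrix.rank_zero).symm.trans he_rank)
  refine ⟨r • x, smul_left_injective ℂ e_ne_zero ?_, e_eq⟩
  have := he.isIdempotentElem.eq
  change _ • e = _ • e
  rw [one_smul]
  nth_rw 2 [← this]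
  rw [e_eq, rankOne_mul_rankOne]

end RankOne

section Sandwich

variable {κ : Type*} [Fintype κ] {D : Type*} [Ring D] [StarRing D] [Algebra ℂ D]

/-- The bilinear map `(b, x) ↦ ∑ₖₗ bₖₗ Yₖ x Yₗ^*` attached to a family `Y` in a `*`-algebra. -/
noncomputable def sandwich (Y : κ → D) : Mat κ →ₗ[ℂ] D →ₗ[ℂ] D :=
  LinearMap.mk₂ ℂ (fun b x => ∑ k, ∑ l, b k l • (Y k * x * star (Y l)))
    (fun b b' x => by simp only [CStarMatrix.add_apply, add_smul, Finset.sum_add_distrib])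
    (fun c b x => by simp_rw [CStarMatrix.smul_apply, smul_assoc, ← Finset.smul_sum])
    (by simp [mul_add, add_mul, Finset.sum_add_distrib])
    (fun c b x => by simp only [mul_smul_comm, smul_mul_assoc, smul_comm _ c, Finset.smul_sum])

variable {Y : κ → D}

theorem sandwich_apply (b : Mat κ) (x : D) :
    sandwich Y b x = ∑ k, ∑ l, b k l • (Y k * x * star (Y l)) := rfl

theorem star_sandwich [StarModule ℂ D] (b : Mat κ) (x : D) :
    star (sandwich Y b x) = sandwich Y (star b) (star x) := by
  simp only [sandwich_apply, star_sum, star_smul, star_mul, star_star, CStarMatrix.star_apply,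
    mul_assoc]
  exact Finset.sum_comm

theorem map_sandwich {D' : Type*} [Ring D'] [StarRing D'] [Algebra ℂ D'] (φ : D →⋆ₐ[ℂ] D')
    (b : Mat κ) (x : D) : φ (sandwich Y b x) = sandwich (φ ∘ Y) b (φ x) := by
  simp only [sandwich_apply, map_sum, map_smul, map_mul, map_star, Function.comp_apply]

theorem sandwich_one [DecidableEq κ] (x : D) : sandwich Y 1 x = ∑ k, Y k * x * star (Y k) := by
  simp [sandwich_apply, CStarMatrix.one_apply]

theorem sandwich_mul_matrixUnit [DecidableEq κ] (a : Mat κ) (k l : κ) (x : D) :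
    sandwich Y (a * matrixUnit k l) x = ∑ m, a m k • (Y m * x * star (Y l)) := by
  simp [sandwich_apply, CStarMatrix.mul_apply, matrixUnit_apply, ite_and]

theorem sandwich_matrixUnit [DecidableEq κ] (k l : κ) (x : D) :
    sandwich Y (matrixUnit k l) x = Y k * x * star (Y l) := by
  simp [sandwich_apply, matrixUnit_apply, ite_and]

theorem mul_sandwich {c d : D} {a p : Mat κ}
    (hc : ∀ l, c * Y l = ∑ k, a k l • Y k + ∑ k, p k l • (Y k * d)) (b : Mat κ) (x : D) :
    c * sandwich Y b x = sandwich Y (a * b) x + sandwich Y (p * b) (d * x) := by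
  classical
  have mul_unit (k l : κ) : c * sandwich Y (matrixUnit k l) x =
      sandwich Y (a * matrixUnit k l) x + sandwich Y (p * matrixUnit k l) (d * x) := by
    simp only [sandwich_mul_matrixUnit, sandwich_matrixUnit, ← mul_assoc, hc, add_mul,
      Finset.sum_mul, smul_mul_assoc]
  rw [eq_sum_matrixUnit b]
  simp only [map_sum, map_smul, LinearMap.sum_apply, LinearMap.smul_apply, Finset.mul_sum,
    mul_smul_comm, mul_unit, smul_add, Finset.sum_add_distrib]

theorem sandwich_mul_sandwich [DecidableEq κ] {q : D}
    (hY : ∀ k l, star (Y k) * Y l = if k = l then q else 0) (b b' : Mat κ) (x x' : D) :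
    sandwich Y b x * sandwich Y b' x' = sandwich Y (b * b') (x * q * x') := by
  have mul_units (k l k' l' : κ) :
      sandwich Y (matrixUnit k l) x * sandwich Y (matrixUnit k' l') x' =
        sandwich Y (matrixUnit k l * matrixUnit k' l') (x * q * x') := by
    calc sandwich Y (matrixUnit k l) x * sandwich Y (matrixUnit k' l') x'
      _ = Y k * x * (star (Y l) * Y k') * x' * star (Y l') := by
        simp only [sandwich_matrixUnit, mul_assoc]
      _ = _ := by
        rw [hY, matrixUnit_mul_matrixUnit]
        split_ifs <;> simp [sandwich_matrixUnit, mul_assoc]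
  rw [eq_sum_matrixUnit b, eq_sum_matrixUnit b']
  simp only [map_sum, map_smul, LinearMap.sum_apply, LinearMap.smul_apply, Finset.sum_mul,
    Finset.mul_sum, smul_mul_smul_comm, mul_units]

end Sandwich

section LastProj

variable {n : ℕ}

theorem directSum_one_add_lastProj : directSum (1 : Mat (Fin n)) 0 + lastProj n = 1 := by
  refine Eq.trans ?_ directSum_one
  ext (i | i) (j | j) <;> simp [directSum, lastProj]

theorem star_lastProj : star (lastProj n) = lastProj n := by
  rw [lastProj, directSum_star, star_zero, star_one]

theorem lastProj_mul_lastProj : lastProj n * lastProj n = lastProj n := by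
  rw [lastProj, directSum_mul, mul_zero, mul_one]

theorem directSum_mul_lastProj (a : Mat (Fin n)) : directSum a 0 * lastProj n = 0 := by
  rw [lastProj, directSum_mul, mul_zero, zero_mul]
  ext (i | i) (j | j) <;> rfl

theorem lastProj_mul_directSum (a : Mat (Fin n)) : lastProj n * directSum a 0 = 0 := by
  rw [lastProj, directSum_mul, mul_zero, zero_mul]
  ext (i | i) (j | j) <;> rfl

end LastProj

/-- Elements of a `*`-algebra satisfying the relations of the generators of the dimension drop
algebra `I_{n,n+1}`: a linear map `ξ` on `M_n` and a row `Y` of `n + 1` elements, which stand for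
`embed` and for the elements `t ↦ √t · 1 ⊗ eₖ e_{n+1}^*` (up to conjugation by a path of unitaries)
of `I_{n,n+1}`. The row is chosen so that neither a unit vector nor a projection enters. -/
@[ext]
structure WeightedUnits (n : ℕ) (D : Type*) [Ring D] [StarRing D] [Algebra ℂ D] where
  ξ : Mat (Fin n) →ₗ[ℂ] D
  Y : Succ n → D
  star_ξ : ∀ a, star (ξ a) = ξ (star a)
  ξ_mul_ξ : ∀ a b, ξ a * ξ b = ξ 1 * ξ (a * b)
  star_Y_mul_Y : ∀ k l, star (Y k) * Y l = if k = l then 1 - ξ 1 else 0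
  ξ_mul_Y_inl : ∀ a j, ξ a * Y (Sum.inl j) = ∑ i, a i j • Y (Sum.inl i)
  ξ_mul_Y_inr : ∀ a j, ξ a * Y (Sum.inr j) = Y (Sum.inr j) * ξ a
  star_Y_inr : ∀ j, star (Y (Sum.inr j)) = Y (Sum.inr j)

namespace WeightedUnits

variable {n : ℕ} {D D' : Type*} [Ring D] [StarRing D] [Algebra ℂ D] [Ring D'] [StarRing D']
  [Algebra ℂ D']

/-- The image of a weighted system under a `*`-homomorphism. -/
def map (S : WeightedUnits n D) (φ : D →⋆ₐ[ℂ] D') : WeightedUnits n D' where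
  ξ := φ.toAlgHom.toLinearMap ∘ₗ S.ξ
  Y := φ ∘ S.Y
  star_ξ a := (map_star φ _).symm.trans (congrArg φ (S.star_ξ a))
  ξ_mul_ξ a b := by simpa using congrArg φ (S.ξ_mul_ξ a b)
  star_Y_mul_Y k l := by simpa [apply_ite φ, map_star] using congrArg φ (S.star_Y_mul_Y k l)
  ξ_mul_Y_inl a j := by simpa using congrArg φ (S.ξ_mul_Y_inl a j)
  ξ_mul_Y_inr a j := by simpa using congrArg φ (S.ξ_mul_Y_inr a j)
  star_Y_inr j := (map_star φ _).symm.trans (congrArg φ (S.star_Y_inr j))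

theorem map_ξ (S : WeightedUnits n D) (φ : D →⋆ₐ[ℂ] D') (a : Mat (Fin n)) :
    (S.map φ).ξ a = φ (S.ξ a) := rfl

/-- The weighted system of pairs formed by two weighted systems. -/
def prod (S : WeightedUnits n D) (T : WeightedUnits n D') : WeightedUnits n (D × D') where
  ξ := S.ξ.prod T.ξ
  Y k := (S.Y k, T.Y k)
  star_ξ a := Prod.ext (S.star_ξ a) (T.star_ξ a)
  ξ_mul_ξ a b := Prod.ext (S.ξ_mul_ξ a b) (T.ξ_mul_ξ a b)
  star_Y_mul_Y k l := by
    have hS := S.star_Y_mul_Y k l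
    have hT := T.star_Y_mul_Y k l
    split_ifs at hS hT ⊢ <;> exact Prod.ext hS hT
  ξ_mul_Y_inl a j := Prod.ext
    ((S.ξ_mul_Y_inl a j).trans (by simp [Prod.fst_sum]))
    ((T.ξ_mul_Y_inl a j).trans (by simp [Prod.snd_sum]))
  ξ_mul_Y_inr a j := Prod.ext (S.ξ_mul_Y_inr a j) (T.ξ_mul_Y_inr a j)
  star_Y_inr j := Prod.ext (S.star_Y_inr j) (T.star_Y_inr j)

variable (S : WeightedUnits n D)

/-- The elements `∑ₖₗ bₖₗ Yₖ Yₗ^*`. -/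
noncomputable def H : Mat (Succ n) →ₗ[ℂ] D := (sandwich S.Y).flip 1

/-- The elements `∑ₖₗ bₖₗ Yₖ ξ(a) Yₗ^*`. -/
noncomputable def W : Mat (Succ n) →ₗ[ℂ] Mat (Fin n) →ₗ[ℂ] D := (sandwich S.Y).compl₂ S.ξ

/-- The element `∑ₖ Yₖ Yₖ^*`, which is central in the algebra generated by the system and stands
for the coordinate function of the interval. -/
noncomputable def z : D := S.H 1

theorem H_apply (b : Mat (Succ n)) : S.H b = sandwich S.Y b 1 := rfl

theorem W_apply (b : Mat (Succ n)) (a : Mat (Fin n)) : S.W b a = sandwich S.Y b (S.ξ a) := rfl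

theorem map_H (φ : D →⋆ₐ[ℂ] D') (b : Mat (Succ n)) : (S.map φ).H b = φ (S.H b) := by
  rw [H_apply, H_apply, map_sandwich, map_one φ]; rfl

theorem map_W (φ : D →⋆ₐ[ℂ] D') (b : Mat (Succ n)) (a : Mat (Fin n)) :
    (S.map φ).W b a = φ (S.W b a) := by
  rw [W_apply, W_apply, map_sandwich]; rfl

theorem map_z (φ : D →⋆ₐ[ℂ] D') : (S.map φ).z = φ S.z := S.map_H φ 1

theorem ξ_mul_Y (a : Mat (Fin n)) (l : Succ n) :
    S.ξ a * S.Y l =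
      ∑ k, directSum a 0 k l • S.Y k + ∑ k, lastProj n k l • (S.Y k * S.ξ a) := by
  rcases l with j | j
  · simp [directSum, lastProj, S.ξ_mul_Y_inl]
  · simp [directSum, lastProj, S.ξ_mul_Y_inr, Subsingleton.elim j 0]

theorem ξ_mul_sandwich (a : Mat (Fin n)) (b : Mat (Succ n)) (x : D) :
    S.ξ a * sandwich S.Y b x =
      sandwich S.Y (directSum a 0 * b) x + sandwich S.Y (lastProj n * b) (S.ξ a * x) :=
  mul_sandwich (S.ξ_mul_Y a) b x

theorem ξ_mul_H (a : Mat (Fin n)) (b : Mat (Succ n)) :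
    S.ξ a * S.H b = S.H (directSum a 0 * b) + S.W (lastProj n * b) a := by
  rw [H_apply, ξ_mul_sandwich, mul_one]; rfl

theorem commute_ξ_one_ξ (a : Mat (Fin n)) : Commute (S.ξ 1) (S.ξ a) := by
  simpa [commute_iff_eq] using (S.ξ_mul_ξ a 1).symm

theorem z_mul_W (b : Mat (Succ n)) (a : Mat (Fin n)) :
    S.z * S.W b a = S.W b a - sandwich S.Y b (S.ξ 1 * S.ξ a) := by
  rw [z, H_apply, W_apply, sandwich_mul_sandwich S.star_Y_mul_Y, ← map_sub]
  congr 1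
  · rw [one_mul]
  · noncomm_ring

theorem W_mul_z (b : Mat (Succ n)) (a : Mat (Fin n)) :
    S.W b a * S.z = S.W b a - sandwich S.Y b (S.ξ 1 * S.ξ a) := by
  rw [z, H_apply, W_apply, sandwich_mul_sandwich S.star_Y_mul_Y, ← map_sub]
  congr 1
  · rw [mul_one]
  · rw [(S.commute_ξ_one_ξ a).eq]; noncomm_ring

theorem ξ_mul_W (a c : Mat (Fin n)) (b : Mat (Succ n)) :
    S.ξ a * S.W b c = S.W (directSum a 0 * b) c + (1 - S.z) * S.W (lastProj n * b) (a * c) := by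
  rw [W_apply, ξ_mul_sandwich, ξ_mul_ξ, sub_mul, one_mul, z_mul_W, sub_sub_cancel]; rfl

theorem H_mul_H (b b' : Mat (Succ n)) : S.H b * S.H b' = S.H (b * b') - S.W (b * b') 1 := by
  simp only [H_apply, W_apply]
  rw [sandwich_mul_sandwich S.star_Y_mul_Y, ← map_sub, one_mul, mul_one]

theorem H_mul_W (b b' : Mat (Succ n)) (a : Mat (Fin n)) :
    S.H b * S.W b' a = S.z * S.W (b * b') a := by
  simp only [z, H_apply, W_apply]
  rw [sandwich_mul_sandwich S.star_Y_mul_Y, sandwich_mul_sandwich S.star_Y_mul_Y, one_mul (b * b')]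

theorem W_mul_W (b b' : Mat (Succ n)) (a a' : Mat (Fin n)) :
    S.W b a * S.W b' a' = S.z * (1 - S.z) * S.W (b * b') (a * a') := by
  have right : S.z * (1 - S.z) * S.W (b * b') (a * a') =
      sandwich S.Y (b * b') ((1 - S.ξ 1) * (S.ξ 1 * S.ξ (a * a'))) := by
    rw [mul_assoc, sub_mul, one_mul, z_mul_W, sub_sub_cancel, z, H_apply,
      sandwich_mul_sandwich S.star_Y_mul_Y, one_mul, one_mul]
  rw [right, W_apply, W_apply, sandwich_mul_sandwich S.star_Y_mul_Y, ← ξ_mul_ξ, ← mul_assoc]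
  congr 2
  rw [mul_sub, sub_mul, mul_one, one_mul, (S.commute_ξ_one_ξ a).eq]

theorem Y_inr_mul_Y_inr : S.Y (Sum.inr 0) * S.Y (Sum.inr 0) = 1 - S.ξ 1 := by
  have := S.star_Y_mul_Y (Sum.inr 0) (Sum.inr 0)
  rwa [if_pos rfl, S.star_Y_inr] at this

theorem H_lastProj : S.H (lastProj n) = 1 - S.ξ 1 := by
  simp [H_apply, sandwich_apply, lastProj, directSum, S.star_Y_inr, S.Y_inr_mul_Y_inr]

theorem W_lastProj (a : Mat (Fin n)) : S.W (lastProj n) a = S.ξ a - S.ξ 1 * S.ξ a := by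
  have h := S.ξ_mul_H a (lastProj n)
  rw [directSum_mul_lastProj, lastProj_mul_lastProj, map_zero, zero_add, H_lastProj] at h
  rw [← h, mul_sub, mul_one, (S.commute_ξ_one_ξ a).eq]

theorem ξ_mul_ξ_eq_sub (a b : Mat (Fin n)) :
    S.ξ a * S.ξ b = S.ξ (a * b) - S.W (lastProj n) (a * b) := by
  rw [W_lastProj, sub_sub_cancel, S.ξ_mul_ξ]

end WeightedUnits

/-- The coefficients of a normal form `ξ(a) + H(b) + ∑ q_{αβ}(z) W(eₖₗ, eᵢⱼ)`, where `α = (k, i)`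
and `β = (l, j)`, in the algebra generated by a weighted system. -/
abbrev Coefficients (n : ℕ) :=
  Mat (Fin n) × Mat (Succ n) × Matrix (Succ n × Fin n) (Succ n × Fin n) ℂ[X]

namespace WeightedUnits

variable {n : ℕ} {D D' : Type*} [Ring D] [StarRing D] [Algebra ℂ D] [Ring D'] [StarRing D']
  [Algebra ℂ D'] (S : WeightedUnits n D)

/-- The words `ξ(a)`, `H(b)` and `zᵐ W(b, a)` that span the `*`-algebra generated by a weighted
system. -/
inductive IsWord : D → Prop
  | ξ (a : Mat (Fin n)) : IsWord (S.ξ a)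
  | H (b : Mat (Succ n)) : IsWord (S.H b)
  | W (m : ℕ) (b : Mat (Succ n)) (a : Mat (Fin n)) : IsWord (S.z ^ m * S.W b a)

/-- The linear span of the words of a weighted system. -/
def span : Submodule ℂ D := Submodule.span ℂ {x | S.IsWord x}

variable {S}

theorem ξ_mem_span (a : Mat (Fin n)) : S.ξ a ∈ S.span := Submodule.subset_span (.ξ a)

theorem H_mem_span (b : Mat (Succ n)) : S.H b ∈ S.span := Submodule.subset_span (.H b)

theorem z_pow_mul_W_mem_span (m : ℕ) (b : Mat (Succ n)) (a : Mat (Fin n)) :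
    S.z ^ m * S.W b a ∈ S.span := Submodule.subset_span (.W m b a)

theorem W_mem_span (b : Mat (Succ n)) (a : Mat (Fin n)) : S.W b a ∈ S.span := by
  simpa using z_pow_mul_W_mem_span 0 b a

theorem one_mem_span : (1 : D) ∈ S.span := by
  rw [← add_sub_cancel (S.ξ 1) 1, ← H_lastProj]
  exact add_mem (ξ_mem_span 1) (H_mem_span _)

theorem commute_z_H (b : Mat (Succ n)) : Commute S.z (S.H b) := by
  rw [commute_iff_eq, z, H_mul_H, H_mul_H, one_mul, mul_one]

theorem commute_z_W (b : Mat (Succ n)) (a : Mat (Fin n)) : Commute S.z (S.W b a) := by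
  rw [commute_iff_eq, z_mul_W, W_mul_z]

section Star

variable [StarModule ℂ D]

theorem star_H (b : Mat (Succ n)) : star (S.H b) = S.H (star b) := by
  rw [H_apply, star_sandwich, star_one]; rfl

theorem star_W (b : Mat (Succ n)) (a : Mat (Fin n)) :
    star (S.W b a) = S.W (star b) (star a) := by
  rw [W_apply, star_sandwich, S.star_ξ]; rfl

theorem isSelfAdjoint_z : IsSelfAdjoint S.z := by
  rw [isSelfAdjoint_iff, z, star_H, star_one]

theorem commute_z_ξ (a : Mat (Fin n)) : Commute S.z (S.ξ a) := by
  have right := S.ξ_mul_H a 1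
  have left := congrArg star (S.ξ_mul_H (star a) 1)
  rw [star_mul, star_add, star_H, star_H, star_W, S.star_ξ, star_star, mul_one, mul_one,
    directSum_star, star_star, star_zero, star_one, star_lastProj] at left
  rw [mul_one, mul_one, ← left] at right
  exact right.symm

theorem star_mem_span {x : D} (hx : x ∈ S.span) : star x ∈ S.span := by
  induction hx using Submodule.span_induction with
  | mem x hx =>
    cases hx with
    | ξ a => exact S.star_ξ a ▸ ξ_mem_span _
    | H b => exact star_H (S := S) b ▸ H_mem_span _
    | W m b a =>
      rw [star_mul, star_pow, isSelfAdjoint_z.star_eq, star_W, ← ((commute_z_W _ _).pow_left m).eq]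
      exact z_pow_mul_W_mem_span m _ _
  | zero => rw [star_zero]; exact zero_mem _
  | add x y _ _ hx hy => exact star_add x y ▸ add_mem hx hy
  | smul c x _ hx => exact star_smul c x ▸ Submodule.smul_mem _ _ hx

theorem ξ_mul_word_mem_span (a : Mat (Fin n)) {y : D} (hy : S.IsWord y) :
    S.ξ a * y ∈ S.span := by
  cases hy with
  | ξ a' =>
    rw [ξ_mul_ξ_eq_sub]
    exact sub_mem (ξ_mem_span _) (W_mem_span _ _)
  | H b =>
    rw [ξ_mul_H]
    exact add_mem (H_mem_span _) (W_mem_span _ _)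
  | W m b c =>
    rw [← mul_assoc, ← ((commute_z_ξ a).pow_left m).eq, mul_assoc, ξ_mul_W, sub_mul, one_mul,
      mul_add, mul_sub, ← mul_assoc _ S.z, ← pow_succ]
    exact add_mem (z_pow_mul_W_mem_span _ _ _)
      (sub_mem (z_pow_mul_W_mem_span _ _ _) (z_pow_mul_W_mem_span _ _ _))

theorem H_mul_word_mem_span (b : Mat (Succ n)) {y : D} (hy : S.IsWord y) :
    S.H b * y ∈ S.span := by
  cases hy with
  | ξ a =>
    rw [← star_star (S.H b * S.ξ a), star_mul, S.star_ξ, star_H]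
    exact star_mem_span (ξ_mul_word_mem_span _ (.H _))
  | H b' =>
    rw [H_mul_H]
    exact sub_mem (H_mem_span _) (W_mem_span _ _)
  | W m b' a =>
    rw [← mul_assoc, ← ((commute_z_H b).pow_left m).eq, mul_assoc, H_mul_W, ← mul_assoc,
      ← pow_succ]
    exact z_pow_mul_W_mem_span _ _ _

theorem z_pow_mul_W_mul_word_mem_span (m : ℕ) (b : Mat (Succ n)) (a : Mat (Fin n)) {y : D}
    (hy : S.IsWord y) : S.z ^ m * S.W b a * y ∈ S.span := by
  have star_word : star (S.z ^ m * S.W b a) = S.z ^ m * S.W (star b) (star a) := by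
    rw [star_mul, star_pow, isSelfAdjoint_z.star_eq, star_W, ← ((commute_z_W _ _).pow_left m).eq]
  cases hy with
  | ξ c =>
    rw [← star_star (_ * S.ξ c), star_mul, S.star_ξ, star_word]
    exact star_mem_span (ξ_mul_word_mem_span _ (.W _ _ _))
  | H c =>
    rw [← star_star (_ * S.H c), star_mul, star_H, star_word]
    exact star_mem_span (H_mul_word_mem_span _ (.W _ _ _))
  | W k b' a' =>
    have normal_form : S.z ^ m * S.W b a * (S.z ^ k * S.W b' a') =
        S.z ^ (m + k + 1) * S.W (b * b') (a * a') - S.z ^ (m + k + 2) * S.W (b * b') (a * a') := by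
      rw [mul_assoc, ← mul_assoc (S.W b a), ← ((commute_z_W b a).pow_left k).eq, mul_assoc,
        W_mul_W, pow_add _ _ 1, pow_add _ _ 2, pow_add]
      noncomm_ring
    rw [normal_form]
    exact sub_mem (z_pow_mul_W_mem_span _ _ _) (z_pow_mul_W_mem_span _ _ _)

theorem mul_mem_span {x y : D} (hx : x ∈ S.span) (hy : y ∈ S.span) : x * y ∈ S.span := by
  induction hx, hy using Submodule.span_induction₂ with
  | mem_mem x y hx hy =>
    cases hx with
    | ξ a => exact ξ_mul_word_mem_span a hy
    | H b => exact H_mul_word_mem_span b hy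
    | W m b a => exact z_pow_mul_W_mul_word_mem_span m b a hy
  | zero_left y _ => rw [zero_mul]; exact zero_mem _
  | zero_right x _ => rw [mul_zero]; exact zero_mem _
  | add_left x₁ x₂ y _ _ _ h₁ h₂ => exact add_mul x₁ x₂ y ▸ add_mem h₁ h₂
  | add_right x y₁ y₂ _ _ _ h₁ h₂ => exact mul_add x y₁ y₂ ▸ add_mem h₁ h₂
  | smul_left c x y _ _ h => exact (smul_mul_assoc c x y).symm ▸ Submodule.smul_mem _ _ h
  | smul_right c x y _ _ h => exact (mul_smul_comm c x y).symm ▸ Submodule.smul_mem _ _ h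

variable (S) in
/-- The span of the words of a weighted system, as a `*`-subalgebra. -/
def starSubalgebra : StarSubalgebra ℂ D where
  __ := S.span.toSubalgebra one_mem_span fun _ _ => mul_mem_span
  star_mem' := star_mem_span

end Star

variable (S) in
/-- The element `ξ(a) + H(b) + ∑ q_{αβ}(z) W(eₖₗ, eᵢⱼ)` with given coefficients. -/
noncomputable def combination : Coefficients n →ₗ[ℂ] D :=
  S.ξ.coprod <| S.H.coprod <| ∑ α, ∑ β,
    LinearMap.mulRight ℂ (S.W (matrixUnit α.1 β.1) (matrixUnit α.2 β.2)) ∘ₗ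
      (aeval S.z).toLinearMap ∘ₗ Matrix.entryLinearMap ℂ ℂ[X] α β

theorem combination_apply (c : Coefficients n) :
    S.combination c = S.ξ c.1 + (S.H c.2.1 + ∑ α, ∑ β,
      aeval S.z (c.2.2 α β) * S.W (matrixUnit α.1 β.1) (matrixUnit α.2 β.2)) := by
  simp [combination]

theorem map_combination (φ : D →⋆ₐ[ℂ] D') (c : Coefficients n) :
    (S.map φ).combination c = φ (S.combination c) := by
  have map_aeval (p : ℂ[X]) : φ (aeval S.z p) = aeval (φ S.z) p :=
    (aeval_algHom_apply φ S.z p).symm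
  simp only [combination_apply, map_ξ, map_H, map_W, map_z, map_add, map_sum, map_mul, map_aeval]

theorem W_eq_sum (b : Mat (Succ n)) (a : Mat (Fin n)) :
    S.W b a = ∑ α : Succ n × Fin n, ∑ β : Succ n × Fin n, (b α.1 β.1 * a α.2 β.2) •
      S.W (matrixUnit α.1 β.1) (matrixUnit α.2 β.2) := by
  calc S.W b a = ∑ k, ∑ l, ∑ i, ∑ j,
        (b k l * a i j) • S.W (matrixUnit k l) (matrixUnit i j) := by
        conv_lhs => rw [eq_sum_matrixUnit b]
        simp only [map_sum, map_smul, LinearMap.sum_apply, LinearMap.smul_apply]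
        refine Finset.sum_congr rfl fun k _ => Finset.sum_congr rfl fun l _ => ?_
        conv_lhs => rw [eq_sum_matrixUnit a]
        simp only [map_sum, map_smul, Finset.smul_sum, mul_smul]
    _ = _ := by
        simp only [Fintype.sum_prod_type]
        exact Finset.sum_congr rfl fun k _ => Finset.sum_comm

theorem combination_mem_span (c : Coefficients n) : S.combination c ∈ S.span := by
  rw [combination_apply]
  refine add_mem (ξ_mem_span _) (add_mem (H_mem_span _) ?_)
  refine sum_mem fun α _ => sum_mem fun β _ => ?_
  rw [aeval_eq_sum_range, Finset.sum_mul]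
  refine sum_mem fun m _ => ?_
  rw [smul_mul_assoc]
  exact Submodule.smul_mem _ _ (z_pow_mul_W_mem_span _ _ _)

theorem exists_combination_eq_of_mem_span {x : D} (hx : x ∈ S.span) :
    ∃ c, S.combination c = x := by
  suffices S.span ≤ LinearMap.range S.combination from this hx
  refine Submodule.span_le.mpr ?_
  rintro _ (a | b | ⟨m, b, a⟩)
  · exact ⟨(a, 0, 0), by simp [combination_apply]⟩
  · exact ⟨(0, b, 0), by simp [combination_apply]⟩
  · refine ⟨(0, 0, fun α β => (b α.1 β.1 * a α.2 β.2) • X ^ m), ?_⟩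
    simp [combination_apply, W_eq_sum b a, Finset.mul_sum]

end WeightedUnits

namespace WeightedUnits

variable {n : ℕ} {D : Type*} [CStarAlgebra D] [PartialOrder D] [StarOrderedRing D]
  {S : WeightedUnits n D}

theorem z_nonneg : 0 ≤ S.z := by
  rw [z, H_apply, sandwich_one]
  simpa using Finset.sum_nonneg fun k (_ : k ∈ Finset.univ) => mul_star_self_nonneg (S.Y k)

theorem z_mul_z_le (hS : 0 ≤ S.ξ 1) : S.z * S.z ≤ S.z := by
  rw [z, H_mul_H, one_mul, sub_le_self_iff, W_apply, sandwich_one]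
  exact Finset.sum_nonneg fun k _ => star_right_conjugate_nonneg hS (S.Y k)

theorem norm_z_le_one (hS : 0 ≤ S.ξ 1) : ‖S.z‖ ≤ 1 := by
  have norm_sq_le : ‖S.z‖ * ‖S.z‖ ≤ ‖S.z‖ := by
    have hz : IsSelfAdjoint S.z := isSelfAdjoint_z
    have := CStarAlgebra.norm_le_norm_of_nonneg_of_le
      (by simpa [hz.star_eq] using star_mul_self_nonneg S.z) (z_mul_z_le hS)
    rwa [← CStarRing.norm_star_mul_self, hz.star_eq]
  by_contra! h
  nlinarith

theorem norm_aeval_z_le (hS : 0 ≤ S.ξ 1) {p : ℂ[X]} {M : ℝ}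
    (hp : ∀ t : unitInterval, ‖p.eval ((t : ℝ) : ℂ)‖ ≤ M) : ‖aeval S.z p‖ ≤ M := by
  have hz : IsSelfAdjoint S.z := isSelfAdjoint_z
  rw [← cfc_polynomial p S.z hz.isStarNormal]
  refine norm_cfc_le ((norm_nonneg _).trans (hp 0)) fun x hx => ?_
  rw [← hz.spectrumRestricts.algebraMap_image] at hx
  obtain ⟨r, hr, rfl⟩ := hx
  have r_nonneg : 0 ≤ r := spectrum_nonneg_of_nonneg z_nonneg hr
  have r_le_one : r ≤ 1 := by
    have : Nontrivial D := not_subsingleton_iff_nontrivial.mp fun _ => by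
      simp [spectrum.of_subsingleton] at hr
    exact (le_abs_self r).trans ((spectrum.norm_le_norm_of_mem hr).trans (norm_z_le_one hS))
  exact hp ⟨r, r_nonneg, r_le_one⟩

theorem norm_aeval_z_mul_W_le (hS : 0 ≤ S.ξ 1) {p : ℂ[X]} {M : ℝ}
    (hp : ∀ t : unitInterval, ‖(X * (1 - X) * p).eval ((t : ℝ) : ℂ)‖ ≤ M) (k l : Succ n)
    (i j : Fin n) : ‖aeval S.z p * S.W (matrixUnit k l) (matrixUnit i j)‖ ≤ M := by
  let w (l : Succ n) (j : Fin n) : D := aeval S.z p * S.W (matrixUnit k l) (matrixUnit i j)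
  have w_mul_star (l j) : w l j * star (w l j) = aeval S.z (X * (1 - X) * p) * star (w k i) := by
    have := S.W_mul_W (matrixUnit k l) (matrixUnit l k) (matrixUnit i j) (matrixUnit j i)
    simp only [matrixUnit_mul_matrixUnit, if_true] at this
    simp only [w, star_mul, star_W, star_matrixUnit, map_mul, map_sub, map_one, aeval_X]
    rw [mul_assoc, ← mul_assoc (S.W _ _), this]
    have commute_p := (Commute.all p (X * (1 - X))).map (aeval S.z)
    rw [map_mul, map_sub, map_one, aeval_X] at commute_p
    rw [← mul_assoc, ← mul_assoc, commute_p.eq, mul_assoc]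
  have norm_sq_le (l j) : ‖w l j‖ * ‖w l j‖ ≤ M * ‖w k i‖ := by
    rw [← CStarRing.norm_self_mul_star, w_mul_star]
    refine (norm_mul_le _ _).trans ?_
    rw [norm_star]
    gcongr
    exact norm_aeval_z_le hS hp
  have hM : 0 ≤ M := (norm_nonneg _).trans (hp 0)
  have norm_w_le : ‖w k i‖ ≤ M := by
    by_contra! h
    nlinarith [norm_sq_le k i]
  exact (mul_self_le_mul_self_iff (norm_nonneg _) hM).mpr ((norm_sq_le l j).trans (by gcongr))

theorem exists_norm_combination_le (hS : 0 ≤ S.ξ 1) :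
    ∃ C : ℝ, ∀ (c : Coefficients n) (M : ℝ), (∀ i j, ‖c.1 i j‖ ≤ M) →
      (∀ k l, ‖c.2.1 k l‖ ≤ M) →
      (∀ α β, ∀ t : unitInterval, ‖(X * (1 - X) * c.2.2 α β).eval ((t : ℝ) : ℂ)‖ ≤ M) →
      ‖S.combination c‖ ≤ C * M := by
  refine ⟨(∑ i, ∑ j, ‖S.ξ (matrixUnit i j)‖) + ((∑ k, ∑ l, ‖S.H (matrixUnit k l)‖) +
    ∑ _α : Succ n × Fin n, ∑ _β : Succ n × Fin n, 1), fun c M ha hb hq => ?_⟩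
  have norm_map_le {ι : Type} [Fintype ι] [DecidableEq ι] (f : Mat ι →ₗ[ℂ] D) {a : Mat ι}
      (ha : ∀ i j, ‖a i j‖ ≤ M) : ‖f a‖ ≤ (∑ i, ∑ j, ‖f (matrixUnit i j)‖) * M := by
    conv_lhs => rw [eq_sum_matrixUnit a]
    simp only [map_sum, map_smul, Finset.sum_mul]
    refine norm_sum_le_of_le _ fun i _ => norm_sum_le_of_le _ fun j _ => ?_
    rw [norm_smul, mul_comm]
    gcongr
    exact ha i j
  rw [combination_apply, add_mul, add_mul]
  refine norm_add_le_of_le (norm_map_le S.ξ ha) (norm_add_le_of_le (norm_map_le S.H hb) ?_)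
  simp only [Finset.sum_mul, one_mul]
  exact norm_sum_le_of_le _ fun α _ => norm_sum_le_of_le _ fun β _ =>
    norm_aeval_z_mul_W_le hS (hq α β) _ _ _ _

end WeightedUnits

section CStarStructure

variable {ι κ : Type*} [Fintype ι] [DecidableEq ι] [Fintype κ] [DecidableEq κ]

-- Instance search does not find the ring structure of `C([0,1], Mat (ι × κ))` needed for the
-- general instance of this class. The instances here are scoped in order not to interfere with the
-- algebraic structure of `dimDrop` outside of this namespace.
scoped instance : SubringClass (StarSubalgebra ℂ C(unitInterval, Mat (ι × κ)))
    C(unitInterval, Mat (ι × κ)) where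
  neg_mem {M} x hx := by simpa using M.smul_mem hx (-1 : ℂ)

theorem isClosed_range_of_mat {ι E : Type*} [Finite ι] [AddCommGroup E] [TopologicalSpace E]
    [IsTopologicalAddGroup E] [Module ℂ E] [ContinuousSMul ℂ E] [T2Space E] (f : Mat ι →ₗ[ℂ] E) :
    IsClosed (Set.range f) := by
  have : FiniteDimensional ℂ (Mat ι) := Matrix.finiteDimensional
  exact Submodule.closed_of_finiteDimensional (LinearMap.range f)

theorem isClosed_dimDrop : IsClosed (dimDrop ι κ : Set C(unitInterval, Mat (ι × κ))) := by
  let left : Mat ι →ₗ[ℂ] Mat (ι × κ) :=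
    { toFun := (kron · 1), map_add' := (kron_add_left · · 1), map_smul' := (kron_smul_left · · 1) }
  let right : Mat κ →ₗ[ℂ] Mat (ι × κ) :=
    { toFun := kron 1, map_add' := kron_add_right 1, map_smul' := (kron_smul_right · 1 ·) }
  have endpoints : (dimDrop ι κ : Set C(unitInterval, Mat (ι × κ))) =
      {f | f 0 ∈ Set.range left} ∩ {f | f 1 ∈ Set.range right} := by
    ext f
    exact and_congr (exists_congr fun _ => eq_comm) (exists_congr fun _ => eq_comm)
  rw [endpoints]
  exact ((isClosed_range_of_mat left).preimage (continuous_eval_const 0)).inter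
    ((isClosed_range_of_mat right).preimage (continuous_eval_const 1))

noncomputable scoped instance : CStarAlgebra (dimDrop ι κ) where
  toCompleteSpace := isClosed_dimDrop.completeSpace_coe
  norm_mul_self_le f :=
    (CStarRing.norm_star_mul_self (x := (f : C(unitInterval, Mat (ι × κ))))).ge

end CStarStructure

section Fiber

variable {n : ℕ}

theorem flip_mul_flip : flip n * flip n = 1 := by
  ext ⟨i, j⟩ ⟨k, l⟩
  rw [flip_mul]
  rcases j with j | j <;> rcases l with l | l <;>
    simp [flip, CStarMatrix.one_apply, and_comm, Fin.fin_one_eq_zero]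

theorem half_one_add_smul_one_add_flip_mem_unitary {w : ℂ} (hw : star w * w = 1) :
    ((1 + w) / 2) • (1 : Mat (Fin n × Succ n)) + ((1 - w) / 2) • flip n ∈
      unitary (Mat (Fin n × Succ n)) := by
  have star_two : star (2 : ℂ) = 2 := by simp
  constructor <;>
  · simp only [star_add, star_smul, flip_star, star_one, star_div₀, star_sub, star_two,
      mul_add, add_mul, smul_mul_smul_comm, mul_one, one_mul, flip_mul_flip]
    match_scalars
    · linear_combination (1 / 2) * hw
    · linear_combination (-1 / 2) * hw

/-- The flip path as a path of unitaries, by which the fibers are conjugated. -/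
noncomputable def flipUnitary (n : ℕ) (t : unitInterval) : unitary (Mat (Fin n × Succ n)) :=
  ⟨flipPath n t, half_one_add_smul_one_add_flip_mem_unitary <| by
    rw [Complex.star_def, Complex.conj_mul', ← Complex.ofReal_mul, Complex.norm_exp_ofReal_mul_I]
    simp⟩

theorem flipPath_mul_star_flipPath (t : unitInterval) :
    flipPath n t * star (flipPath n t) = 1 := (flipUnitary n t).2.2

/-- The identification of `ℂ^{n+1} ⊗ ℂ^n = (ℂ^n ⊗ ℂ^n) ⊕ ℂ^n` with `ℂ^n ⊗ ℂ^{n+1}` that flips only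
the tensor factors of the second summand. -/
def swapEquiv (n : ℕ) : Succ n × Fin n ≃ Fin n × Succ n where
  toFun p := Sum.elim (fun i => (i, Sum.inl p.2)) (fun j => (p.2, Sum.inr j)) p.1
  invFun p := Sum.elim (fun j => (Sum.inl p.1, j)) (fun j => (Sum.inr j, p.1)) p.2
  left_inv := by rintro ⟨i | i, j⟩ <;> rfl
  right_inv := by rintro ⟨i, j | j⟩ <;> rfl

/-- Conjugation by `u_t`, read in `M_{n+1} ⊗ M_n`. -/
noncomputable def fiberEquiv (t : unitInterval) :
    Mat (Fin n × Succ n) ≃⋆ₐ[ℂ] Mat (Succ n × Fin n) :=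
  (Unitary.conjStarAlgAut ℂ _ (flipUnitary n t)).trans
    (CStarMatrix.reindexₐ ℂ ℂ (swapEquiv n).symm)

theorem fiberEquiv_apply (t : unitInterval) (x : Mat (Fin n × Succ n)) (p q : Succ n × Fin n) :
    fiberEquiv t x p q =
      (flipPath n t * x * star (flipPath n t)) (swapEquiv n p) (swapEquiv n q) := rfl

theorem fiberEquiv_conj_apply (t : unitInterval) (x : Mat (Fin n × Succ n))
    (p q : Succ n × Fin n) :
    fiberEquiv t (star (flipPath n t) * x * flipPath n t) p q =
      x (swapEquiv n p) (swapEquiv n q) := by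
  rw [fiberEquiv_apply]
  simp only [← mul_assoc, flipPath_mul_star_flipPath, one_mul]
  rw [mul_assoc, flipPath_mul_star_flipPath, mul_one]

variable (n) in
/-- The evaluation at `t` after conjugation by `u_t`. It turns `I_{n,n+1}` into an algebra of
functions with values in `M_{n+1} ⊗ M_n` on which the generators are affine combinations of constant
elementary tensors. -/
noncomputable def fiber (t : unitInterval) :
    dimDrop (Fin n) (Succ n) →⋆ₐ[ℂ] Mat (Succ n × Fin n) :=
  let φ := fiberEquiv t
  { toFun := fun f => φ ((f : C(unitInterval, Mat (Fin n × Succ n))) t)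
    map_one' := map_one φ
    map_mul' := fun _ _ => map_mul φ _ _
    map_zero' := map_zero φ
    map_add' := fun _ _ => map_add φ _ _
    commutes' := fun c => AlgHomClass.commutes φ c
    map_star' := fun _ => map_star φ _ }

theorem fiber_apply (t : unitInterval) (f : dimDrop (Fin n) (Succ n)) :
    fiber n t f = fiberEquiv t ((f : C(unitInterval, Mat (Fin n × Succ n))) t) := rfl

theorem fiber_ext {f g : dimDrop (Fin n) (Succ n)} (h : ∀ t, fiber n t f = fiber n t g) : f = g :=
  Subtype.ext <| ContinuousMap.ext fun t => (fiberEquiv t).injective (h t)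

theorem norm_le_of_forall_norm_fiber_le {f : dimDrop (Fin n) (Succ n)} {M : ℝ} (hM : 0 ≤ M)
    (h : ∀ t, ‖fiber n t f‖ ≤ M) : ‖f‖ ≤ M :=
  (ContinuousMap.norm_le (f : C(unitInterval, Mat (Fin n × Succ n))) hM).mpr fun t =>
    (StarAlgEquiv.norm_map (fiberEquiv t) _).ge.trans (h t)

theorem norm_fiber_apply_le (t : unitInterval) (f : dimDrop (Fin n) (Succ n))
    (p q : Succ n × Fin n) : ‖fiber n t f p q‖ ≤ ‖f‖ :=
  CStarMatrix.norm_entry_le_norm.trans (NonUnitalStarAlgHom.norm_apply_le (fiber n t) f)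

theorem continuous_fiber (f : dimDrop (Fin n) (Succ n)) : Continuous fun t => fiber n t f := by
  have := continuous_flipPath n
  have : Continuous fun t => flipPath n t * (f : C(unitInterval, Mat (Fin n × Succ n))) t *
      star (flipPath n t) := by fun_prop
  exact continuous_pi fun p => continuous_pi fun q =>
    (continuous_apply_apply (ρ := fun _ _ => ℂ) (swapEquiv n p) (swapEquiv n q)).comp this

theorem fiber_congr {t : unitInterval} {f g : dimDrop (Fin n) (Succ n)}
    (h : (f : C(unitInterval, Mat (Fin n × Succ n))) t =
      (g : C(unitInterval, Mat (Fin n × Succ n))) t) : fiber n t f = fiber n t g :=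
  congrArg (fiberEquiv t) h

theorem fiber_embed (t : unitInterval) (x : Mat (Fin n)) :
    fiber n t (embed x) =
      kron (directSum x 0) 1 + (1 - ((t : ℝ) : ℂ)) • kron (lastProj n) x := by
  ext p q
  refine (fiberEquiv_conj_apply t _ p q).trans ?_
  obtain ⟨i | i, j⟩ := p <;> obtain ⟨k | k, l⟩ := q <;>
    simp [swapEquiv, kron_apply, directSum, lastProj, CStarMatrix.one_apply, Fin.fin_one_eq_zero,
      mul_comm]

theorem fiber_corner (t : unitInterval) (h : Fin n → ℂ) :
    fiber n t (corner h) = (√(t : ℝ) : ℂ) • kron (lastCol h) 1 := by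
  ext p q
  rw [fiber_apply, corner, ContinuousMap.coe_mk, map_smul, CStarMatrix.smul_apply,
    fiberEquiv_conj_apply]
  obtain ⟨i | i, j⟩ := p <;> obtain ⟨k | k, l⟩ := q <;>
    simp [swapEquiv, kron_apply, cornerMat, lastCol, CStarMatrix.one_apply]

theorem fiber_one {f : dimDrop (Fin n) (Succ n)} {b : Mat (Succ n)}
    (hf : (f : C(unitInterval, Mat (Fin n × Succ n))) 1 = kron 1 b) :
    fiber n 1 f = kron b 1 := by
  ext p q
  rw [fiber_apply, fiberEquiv_apply, hf, flipPath_one, flip_star]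
  obtain ⟨i | i, j⟩ := p <;> obtain ⟨k | k, l⟩ := q <;>
  · rw [swapEquiv, Equiv.coe_fn_mk, mul_flip, flip_mul]
    simp [kron_apply, CStarMatrix.one_apply, Fin.fin_one_eq_zero, mul_comm]

theorem flipPath_mul_kron_one_lastProj (t : unitInterval) :
    flipPath n t * kron 1 (lastProj n) = kron 1 (lastProj n) * flipPath n t := by
  have flip_mul_kron : flip n * kron 1 (lastProj n) = kron 1 (lastProj n) * flip n := by
    ext ⟨i, j⟩ ⟨k, l⟩
    rw [flip_mul, mul_flip]
    rcases j with j | j <;> rcases l with l | l <;>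
      simp [kron_apply, lastProj, directSum, CStarMatrix.one_apply]
  simp only [flipPath, add_mul, mul_add, smul_mul_assoc, mul_smul_comm, one_mul, mul_one,
    flip_mul_kron]

/-- The element `t ↦ c(t) (1 ⊗ e_{n+1,n+1})` of `I_{n,n+1}`, where `c(0) = 0`. -/
noncomputable def lastPath (c : C(unitInterval, ℂ)) (hc : c 0 = 0) : dimDrop (Fin n) (Succ n) :=
  ⟨⟨fun t => c t • kron 1 (lastProj n), by fun_prop⟩,
    ⟨0, by ext p q; simp [hc, kron_apply]⟩, c 1 • lastProj n, (kron_smul_right _ _ _).symm⟩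

theorem fiber_lastPath (t : unitInterval) (c : C(unitInterval, ℂ)) (hc : c 0 = 0) :
    fiber n t (lastPath c hc) = c t • kron (lastProj n) 1 := by
  ext p q
  rw [fiber_apply, lastPath, ContinuousMap.coe_mk, map_smul, CStarMatrix.smul_apply,
    fiberEquiv_apply, flipPath_mul_kron_one_lastProj, mul_assoc,
    flipPath_mul_star_flipPath, mul_one]
  obtain ⟨i | i, j⟩ := p <;> obtain ⟨k | k, l⟩ := q <;>
    simp [swapEquiv, kron_apply, lastProj, directSum, mul_comm]

variable (n) in
/-- The element `t ↦ √t (1 ⊗ e_{n+1,n+1})` of `I_{n,n+1}`. It is the absolute value of `corner h`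
for every unit vector `h`. -/
noncomputable def absCorner : dimDrop (Fin n) (Succ n) :=
  lastPath ⟨fun t => (√(t : ℝ) : ℂ), by fun_prop⟩ (by simp)

theorem fiber_absCorner (t : unitInterval) :
    fiber n t (absCorner n) = (√(t : ℝ) : ℂ) • kron (lastProj n) 1 :=
  fiber_lastPath t _ _

end Fiber

section Generators

variable {n : ℕ}

theorem ofReal_sqrt_mul_ofReal_sqrt (t : unitInterval) :
    (√(t : ℝ) : ℂ) * √(t : ℝ) = ((t : ℝ) : ℂ) := by
  rw [← Complex.ofReal_mul, Real.mul_self_sqrt t.2.1]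

theorem exists_absCorner_eq_star_mul_self (n : ℕ) : ∃ r, absCorner n = star r * r := by
  refine ⟨lastPath ⟨fun t => (√√(t : ℝ) : ℂ), by fun_prop⟩ (by simp), fiber_ext fun t => ?_⟩
  rw [map_mul, map_star, fiber_absCorner, fiber_lastPath, star_smul, kron_star, star_lastProj,
    star_one, smul_mul_smul_comm, kron_mul, lastProj_mul_lastProj, mul_one]
  congr 1
  rw [ContinuousMap.coe_mk, Complex.star_def, Complex.conj_ofReal, ← Complex.ofReal_mul,
    Real.mul_self_sqrt (Real.sqrt_nonneg _)]

variable (n) in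
/-- The order zero embedding `embed` as a linear map. -/
noncomputable def embedₗ : Mat (Fin n) →ₗ[ℂ] dimDrop (Fin n) (Succ n) where
  toFun := embed
  map_add' x y := Subtype.ext <| ContinuousMap.ext fun t => by
    simp [embed, kron_add_left, mul_add, add_mul]
  map_smul' c x := Subtype.ext <| ContinuousMap.ext fun t => by
    simp [embed, kron_smul_left]

theorem lastProj_eq_matrixUnit : lastProj n = matrixUnit (Sum.inr 0) (Sum.inr 0) := by
  ext (i | i) (j | j) <;>
    simp [lastProj, directSum, matrixUnit_apply, Fin.fin_one_eq_zero]

theorem lastCol_single (i : Fin n) :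
    lastCol (Pi.single i 1) = matrixUnit (Sum.inl i) (Sum.inr 0) := by
  ext (k | k) (l | l) <;>
    simp [lastCol, matrixUnit_apply, Fin.fin_one_eq_zero, Pi.single_apply, eq_comm]

/-- The element `t ↦ √t u_t^* (eₖ e_{n+1}^* ⊗ 1) u_t` of `I_{n,n+1}`, with the tensor factors
ordered as in `fiber`. -/
noncomputable def columnPath : Succ n → dimDrop (Fin n) (Succ n)
  | Sum.inl i => corner (Pi.single i 1)
  | Sum.inr _ => absCorner n

theorem fiber_columnPath (t : unitInterval) (k : Succ n) :
    fiber n t (columnPath k) = (√(t : ℝ) : ℂ) • kron (matrixUnit k (Sum.inr 0)) 1 := by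
  rcases k with i | i
  · rw [columnPath, fiber_corner, lastCol_single]
  · rw [columnPath, fiber_absCorner, lastProj_eq_matrixUnit, Subsingleton.elim i 0]

end Generators

section Kron

variable {ι κ : Type*} [DecidableEq ι] [DecidableEq κ]

theorem kron_matrixUnit (i i' : ι) (j j' : κ) :
    kron (matrixUnit i i') (matrixUnit j j') = matrixUnit (i, j) (i', j') := by
  ext p q
  simp only [kron_apply, matrixUnit_apply, Prod.ext_iff, ← ite_and, ite_mul, one_mul, zero_mul]
  exact if_congr (by tauto) rfl rfl

theorem kron_matrixUnit_mul_mul_kron_matrixUnit_apply [Fintype ι] [Fintype κ] (i j k l : ι)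
    (m : Mat (ι × κ)) (p q : ι × κ) :
    (kron (matrixUnit i j) (1 : Mat κ) * m * kron (matrixUnit k l) (1 : Mat κ) : Mat (ι × κ)) p q =
      if i = p.1 ∧ l = q.1 then m (j, p.2) (k, q.2) else 0 := by
  simp only [CStarMatrix.mul_apply, Fintype.sum_prod_type, kron_apply, matrixUnit_apply,
    CStarMatrix.one_apply]
  simp only [mul_ite, ite_mul, one_mul, zero_mul, mul_one, mul_zero, ite_and, Finset.sum_ite_eq,
    Finset.sum_ite_eq', Finset.mem_univ, if_true]
  split_ifs <;> simp

end Kron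

section BumpPath

variable {ι : Type*}

/-- The path in `M_ι` with entries `t (1 - t) qᵢⱼ(t)`. These paths are dense among the continuous
paths that vanish at both end points. -/
noncomputable def bumpPath (q : Matrix ι ι ℂ[X]) (t : unitInterval) : Mat ι :=
  CStarMatrix.ofMatrix fun i j => (X * (1 - X) * q i j).eval ((t : ℝ) : ℂ)

theorem bumpPath_apply (q : Matrix ι ι ℂ[X]) (t : unitInterval) (i j : ι) :
    bumpPath q t i j = (X * (1 - X) * q i j).eval ((t : ℝ) : ℂ) := rfl

theorem bumpPath_zero (q : Matrix ι ι ℂ[X]) : bumpPath q 0 = 0 := by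
  ext i j
  simp [bumpPath_apply]

theorem bumpPath_one (q : Matrix ι ι ℂ[X]) : bumpPath q 1 = 0 := by
  ext i j
  simp [bumpPath_apply]

end BumpPath

section Polynomials

theorem X_mul_one_sub_X_dvd {p : ℂ[X]} (h₀ : p.eval 0 = 0) (h₁ : p.eval 1 = 0) :
    X * (1 - X) ∣ p := by
  refine IsCoprime.mul_dvd ⟨1, 1, by ring⟩ (by rwa [X_dvd_iff, coeff_zero_eq_eval_zero]) ?_
  rw [← neg_dvd, neg_sub, ← C_1]
  exact dvd_iff_isRoot.mpr h₁

theorem exists_polynomial_eval_eq_bernsteinApproximation {ι : Type*} (N : ℕ)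
    (g : C(unitInterval, Mat ι)) (i j : ι) :
    ∃ p : ℂ[X], ∀ t : unitInterval,
      p.eval ((t : ℝ) : ℂ) = bernsteinApproximation N g t i j := by
  refine ⟨∑ k : Fin (N + 1), C (g (bernstein.z k) i j) * bernsteinPolynomial ℂ N k,
    fun t => ?_⟩
  let entry : Mat ι →ₗ[ℝ] ℂ := Matrix.entryLinearMap ℝ ℂ i j
  refine Eq.trans ?_ (congrArg entry (bernsteinApproximation.apply N g t)).symm
  rw [eval_finsetSum, map_sum]
  refine Finset.sum_congr rfl fun k _ => ?_
  rw [map_smul]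
  change _ = _ • g (bernstein.z k) i j
  simp [bernstein_apply, bernsteinPolynomial, mul_comm]

theorem exists_norm_bumpPath_sub_le {ι : Type*} [Fintype ι]
    (g : C(unitInterval, Mat ι)) (h₀ : g 0 = 0) (h₁ : g 1 = 0) {ε : ℝ} (hε : 0 < ε) :
    ∃ q : Matrix ι ι ℂ[X], ∀ t : unitInterval,
      ‖bumpPath q t - g t‖ ≤ ε := by
  have : LocallyConvexSpace ℝ (Mat ι) :=
    inferInstanceAs (LocallyConvexSpace ℝ (ι → ι → ℂ))
  obtain ⟨N, norm_le, N_ne_zero⟩ := (((bernsteinApproximation_uniform g).eventually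
    (Metric.closedBall_mem_nhds g hε)).and (Filter.eventually_ne_atTop 0)).exists
  choose p hp using exists_polynomial_eval_eq_bernsteinApproximation N g
  have dvd_p (i j) : X * (1 - X) ∣ p i j := by
    refine X_mul_one_sub_X_dvd ?_ ?_
    · simpa [h₀] using hp i j 0
    · simpa [h₁, N_ne_zero] using hp i j 1
  choose q hq using dvd_p
  refine ⟨Matrix.of q, fun t => ?_⟩
  have bumpPath_eq : bumpPath (Matrix.of q) t = bernsteinApproximation N g t := by
    ext i j
    rw [bumpPath_apply, Matrix.of_apply, ← hq, hp]
  rw [bumpPath_eq, ← dist_eq_norm]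
  exact (ContinuousMap.dist_apply_le_dist t).trans norm_le

end Polynomials

section Model

variable {n : ℕ}

theorem kron_zero_left {ι κ : Type*} (b : Mat κ) : kron (0 : Mat ι) b = 0 := by
  ext p q
  simp [kron_apply]

theorem star_columnPath_mul_columnPath (k l : Succ n) :
    star (columnPath k) * columnPath l = if k = l then 1 - embed 1 else 0 := by
  refine fiber_ext fun t => ?_
  have fiber_embed_one : (1 : Mat (Succ n × Fin n)) - fiber n t (embed 1) =
      ((t : ℝ) : ℂ) • kron (lastProj n) 1 := by
    rw [fiber_embed, ← kron_one, ← directSum_one_add_lastProj, kron_add_left]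
    module
  rw [map_mul, map_star, fiber_columnPath, fiber_columnPath, star_smul, kron_star,
    star_matrixUnit, star_one, smul_mul_smul_comm, kron_mul, matrixUnit_mul_matrixUnit, mul_one,
    Complex.star_def, Complex.conj_ofReal, ofReal_sqrt_mul_ofReal_sqrt, ← lastProj_eq_matrixUnit]
  split_ifs with h
  · rw [map_sub, map_one, fiber_embed_one]
  · rw [map_zero, kron_zero_left, smul_zero]

theorem directSum_mul_lastCol (a : Mat (Fin n)) (h : Fin n → ℂ) :
    directSum a 0 * lastCol h = lastCol fun i => ∑ j, a i j * h j := by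
  ext (i | i) (j | j) <;> simp [directSum, lastCol, CStarMatrix.mul_apply]

theorem lastProj_mul_lastCol (h : Fin n → ℂ) : lastProj n * lastCol h = 0 := by
  ext (i | i) (j | j) <;> simp [directSum, lastProj, lastCol, CStarMatrix.mul_apply]

theorem embed_mul_corner (a : Mat (Fin n)) (h : Fin n → ℂ) :
    embed a * corner h = corner fun i => ∑ j, a i j * h j := by
  refine fiber_ext fun t => ?_
  rw [map_mul, fiber_embed, fiber_corner, fiber_corner, mul_smul_comm, add_mul, smul_mul_assoc,
    kron_mul, kron_mul, directSum_mul_lastCol, lastProj_mul_lastCol, mul_one,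
    kron_zero_left, smul_zero, add_zero]

theorem corner_add (h h' : Fin n → ℂ) : corner (h + h') = corner h + corner h' := by
  refine fiber_ext fun t => ?_
  simp only [map_add, fiber_corner, ← smul_add, ← kron_add_left]
  congr 2
  ext (i | i) (j | j) <;> simp [lastCol]

theorem corner_smul (c : ℂ) (h : Fin n → ℂ) : corner (c • h) = c • corner h := by
  refine fiber_ext fun t => ?_
  rw [map_smul, fiber_corner, fiber_corner, smul_comm c, ← kron_smul_left c]
  congr 2
  ext (i | i) (j | j) <;> simp [lastCol]

theorem corner_eq_sum_single (h : Fin n → ℂ) : corner h = ∑ i, h i • corner (Pi.single i 1) := by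
  let cornerₗ : (Fin n → ℂ) →ₗ[ℂ] dimDrop (Fin n) (Succ n) :=
    { toFun := corner, map_add' := corner_add, map_smul' := corner_smul }
  calc cornerₗ h = cornerₗ (∑ i, h i • Pi.single i 1) := by rw [← pi_eq_sum_univ']
    _ = ∑ i, h i • cornerₗ (Pi.single i 1) := by simp only [map_sum, map_smul]

variable (n) in
/-- The weighted system of generators of `I_{n,n+1}`, to which every other one is compared. -/
noncomputable def model : WeightedUnits n (dimDrop (Fin n) (Succ n)) where
  ξ := embedₗ n
  Y := columnPath
  star_ξ a := fiber_ext fun t => by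
    simp [embedₗ, map_star, fiber_embed, kron_star, directSum_star, star_lastProj]
  ξ_mul_ξ a b := fiber_ext fun t => by
    change fiber n t (embed a * embed b) = fiber n t (embed 1 * embed (a * b))
    simp only [map_mul, fiber_embed, add_mul, mul_add, smul_mul_assoc, mul_smul_comm, kron_mul,
      directSum_mul, directSum_mul_lastProj, lastProj_mul_directSum, lastProj_mul_lastProj,
      kron_zero_left, one_mul, mul_one, mul_zero]
  star_Y_mul_Y := star_columnPath_mul_columnPath
  ξ_mul_Y_inl a j := by
    change embed a * corner (Pi.single j 1) = ∑ i, a i j • corner (Pi.single i 1)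
    rw [embed_mul_corner, corner_eq_sum_single]
    simp [Pi.single_apply]
  ξ_mul_Y_inr a j := fiber_ext fun t => by
    simp only [columnPath, embedₗ, LinearMap.coe_mk, AddHom.coe_mk, map_mul, fiber_embed,
      fiber_absCorner, mul_smul_comm, smul_mul_assoc, mul_add, add_mul, kron_mul]
    simp only [directSum_mul_lastProj, lastProj_mul_directSum, kron_zero_left, one_mul, mul_one,
      smul_zero, zero_add, smul_comm (1 - ((t : ℝ) : ℂ)), lastProj_mul_lastProj]
  star_Y_inr j := fiber_ext fun t => by
    simp only [columnPath, map_star, fiber_absCorner, star_smul, kron_star, star_lastProj,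
      star_one, Complex.star_def, Complex.conj_ofReal]

theorem fiber_sandwich_columnPath_apply (t : unitInterval) (b : Mat (Succ n))
    (x : dimDrop (Fin n) (Succ n)) (p q : Succ n × Fin n) :
    fiber n t (sandwich columnPath b x) p q =
      ((t : ℝ) : ℂ) * b p.1 q.1 * fiber n t x (Sum.inr 0, p.2) (Sum.inr 0, q.2) := by
  have fiber_unit (k l : Succ n) : fiber n t (columnPath k * x * star (columnPath l)) =
      ((t : ℝ) : ℂ) • (kron (matrixUnit k (Sum.inr 0)) 1 * fiber n t x *
        kron (matrixUnit (Sum.inr 0) l) 1) := by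
    rw [map_mul, map_mul, map_star, fiber_columnPath, fiber_columnPath, star_smul, kron_star,
      star_matrixUnit, star_one, smul_mul_assoc, smul_mul_smul_comm, Complex.star_def,
      Complex.conj_ofReal, ofReal_sqrt_mul_ofReal_sqrt]
  let entry : Mat (Succ n × Fin n) →ₗ[ℂ] ℂ := Matrix.entryLinearMap ℂ ℂ p q
  calc entry (fiber n t (sandwich columnPath b x))
    _ = ∑ k, ∑ l, b k l * (((t : ℝ) : ℂ) * entry (kron (matrixUnit k (Sum.inr 0)) 1 *
          fiber n t x * kron (matrixUnit (Sum.inr 0) l) 1)) := by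
      simp only [sandwich_apply, map_sum, map_smul, fiber_unit, smul_eq_mul]
    _ = ∑ k, ∑ l, b k l * (((t : ℝ) : ℂ) * if k = p.1 ∧ l = q.1 then
          fiber n t x (Sum.inr 0, p.2) (Sum.inr 0, q.2) else 0) := by
      congr! 4 with k _ l
      exact kron_matrixUnit_mul_mul_kron_matrixUnit_apply k _ _ l _ p q
    _ = _ := by
      simp [ite_and]
      ring

theorem fiber_H_model (t : unitInterval) (b : Mat (Succ n)) :
    fiber n t ((model n).H b) = ((t : ℝ) : ℂ) • kron b 1 := by
  ext p q
  refine (fiber_sandwich_columnPath_apply t b 1 p q).trans ?_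
  simp [map_one, kron_apply, CStarMatrix.one_apply]

theorem fiber_z_model (t : unitInterval) : fiber n t (model n).z = ((t : ℝ) : ℂ) • 1 := by
  rw [WeightedUnits.z, fiber_H_model, kron_one]

theorem fiber_W_model (t : unitInterval) (b : Mat (Succ n)) (a : Mat (Fin n)) :
    fiber n t ((model n).W b a) = (((t : ℝ) : ℂ) * (1 - (t : ℝ))) • kron b a := by
  ext p q
  refine (fiber_sandwich_columnPath_apply t b (embed a) p q).trans ?_
  rw [fiber_embed]
  simp [kron_apply, directSum, lastProj]
  ring

theorem fiber_combination_model (t : unitInterval) (c : Coefficients n) :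
    fiber n t ((model n).combination c) = fiber n t (embed c.1) + ((t : ℝ) : ℂ) • kron c.2.1 1 +
      bumpPath c.2.2 t := by
  have map_aeval (p : ℂ[X]) : fiber n t (aeval (model n).z p) = p.eval ((t : ℝ) : ℂ) • 1 := by
    refine (aeval_algHom_apply (fiber n t).toAlgHom _ p).symm.trans ?_
    refine (congrArg (aeval · p) (fiber_z_model t)).trans ?_
    rw [← Algebra.algebraMap_eq_smul_one, aeval_algebraMap_apply, Algebra.algebraMap_eq_smul_one]
    rfl
  have model_ξ : (model n).ξ c.1 = embed c.1 := rfl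
  rw [WeightedUnits.combination_apply, model_ξ, map_add, map_add, fiber_H_model, add_assoc]
  congr 2
  refine Eq.trans ?_ (eq_sum_matrixUnit _).symm
  simp only [map_sum, map_mul, map_aeval, fiber_W_model, kron_matrixUnit, smul_one_mul, smul_smul,
    bumpPath_apply, eval_mul, eval_X, eval_sub, eval_one, mul_comm (eval _ (c.2.2 _ _))]

theorem fiber_zero_combination_model (c : Coefficients n) :
    fiber n 0 ((model n).combination c) = fiber n 0 (embed c.1) := by
  simp [fiber_combination_model, bumpPath_zero]

theorem fiber_one_combination_model (c : Coefficients n) :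
    fiber n 1 ((model n).combination c) = kron (directSum c.1 0 + c.2.1) 1 := by
  simp [fiber_combination_model, bumpPath_one, fiber_embed, kron_add_left]

theorem bumpPath_eq_fiber_combination_model_sub (t : unitInterval) (c : Coefficients n) :
    bumpPath c.2.2 t = fiber n t ((model n).combination c) -
      ((1 - ((t : ℝ) : ℂ)) • fiber n 0 ((model n).combination c) +
        ((t : ℝ) : ℂ) • fiber n 1 ((model n).combination c)) := by
  rw [fiber_zero_combination_model, fiber_one_combination_model, fiber_combination_model,
    fiber_embed, fiber_embed, kron_add_left]
  simp only [Set.Icc.coe_zero, Complex.ofReal_zero, sub_zero, one_smul]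
  module

theorem fiber_zero_eq_fiber_embed {f : dimDrop (Fin n) (Succ n)} {a : Mat (Fin n)}
    (hf : (f : C(unitInterval, Mat (Fin n × Succ n))) 0 = kron a 1) :
    fiber n 0 f = fiber n 0 (embed a) := by
  refine fiber_congr (hf.trans ?_)
  rw [embed, ContinuousMap.coe_mk, flipPath_zero, Set.Icc.coe_zero, Complex.ofReal_zero,
    zero_smul ℂ, star_one, one_mul, mul_one, sub_zero]

theorem denseRange_combination_model : DenseRange (model n).combination := by
  intro f
  obtain ⟨a, ha⟩ := f.2.1
  obtain ⟨b, hb⟩ := f.2.2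
  let remainder : C(unitInterval, Mat (Succ n × Fin n)) :=
    ⟨fun t => fiber n t f - ((1 - ((t : ℝ) : ℂ)) • fiber n 0 f + ((t : ℝ) : ℂ) • fiber n 1 f), by
      have := continuous_fiber f
      fun_prop⟩
  refine Metric.mem_closure_iff.mpr fun ε hε => ?_
  have remainder_zero : remainder 0 = 0 := by
    simp only [remainder, ContinuousMap.coe_mk, Set.Icc.coe_zero, Complex.ofReal_zero]
    module
  have remainder_one : remainder 1 = 0 := by
    simp only [remainder, ContinuousMap.coe_mk, Set.Icc.coe_one, Complex.ofReal_one]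
    module
  obtain ⟨q, hq⟩ := exists_norm_bumpPath_sub_le remainder remainder_zero remainder_one
    (half_pos hε)
  let c : Coefficients n := (a, b - directSum a 0, q)
  refine ⟨_, ⟨c, rfl⟩, ?_⟩
  rw [dist_comm, dist_eq_norm]
  refine (norm_le_of_forall_norm_fiber_le (half_pos hε).le fun t => ?_).trans_lt (half_lt_self hε)
  have fiber_zero_eq : fiber n 0 ((model n).combination c) = fiber n 0 f := by
    rw [fiber_zero_combination_model, fiber_zero_eq_fiber_embed ha]
  have fiber_one_eq : fiber n 1 ((model n).combination c) = fiber n 1 f := by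
    rw [fiber_one_combination_model, fiber_one hb, add_sub_cancel]
  convert hq t using 2
  rw [bumpPath_eq_fiber_combination_model_sub t c, fiber_zero_eq, fiber_one_eq, map_sub]
  simp only [remainder, ContinuousMap.coe_mk]
  abel

theorem norm_fst_apply_le (c : Coefficients n) (i j : Fin n) :
    ‖c.1 i j‖ ≤ ‖(model n).combination c‖ := by
  have := norm_fiber_apply_le 0 ((model n).combination c) (Sum.inr 0, i) (Sum.inr 0, j)
  rw [fiber_zero_combination_model, fiber_embed] at this
  simpa [kron_apply, directSum, lastProj] using this

theorem norm_snd_apply_le [NeZero n] (c : Coefficients n) (k l : Succ n) :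
    ‖c.2.1 k l‖ ≤ 2 * ‖(model n).combination c‖ := by
  have norm_add_le := norm_fiber_apply_le 1 ((model n).combination c) (k, 0) (l, 0)
  rw [fiber_one_combination_model, kron_apply, CStarMatrix.one_apply_eq, mul_one,
    CStarMatrix.add_apply] at norm_add_le
  have norm_directSum_le : ‖directSum c.1 (0 : Mat (Fin 1)) k l‖ ≤ ‖(model n).combination c‖ := by
    obtain i | i := k <;> obtain j | j := l
    · exact norm_fst_apply_le c i j
    all_goals simp [directSum]
  linarith [norm_sub_le (directSum c.1 (0 : Mat (Fin 1)) k l + c.2.1 k l) (directSum c.1 0 k l),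
    congrArg norm (add_sub_cancel_left (directSum c.1 (0 : Mat (Fin 1)) k l) (c.2.1 k l))]

theorem norm_bumpPath_apply_le (c : Coefficients n) (t : unitInterval) (α β : Succ n × Fin n) :
    ‖bumpPath c.2.2 t α β‖ ≤ 2 * ‖(model n).combination c‖ := by
  set x := (model n).combination c
  have norm_interpolation_le :
      ‖(1 - ((t : ℝ) : ℂ)) * fiber n 0 x α β + ((t : ℝ) : ℂ) * fiber n 1 x α β‖ ≤ ‖x‖ := by
    have norm_one_sub : ‖1 - ((t : ℝ) : ℂ)‖ = 1 - t := by
      rw [← Complex.ofReal_one, ← Complex.ofReal_sub, Complex.norm_of_nonneg (sub_nonneg.mpr t.2.2)]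
    calc _ ≤ (1 - t) * ‖x‖ + t * ‖x‖ := by
          refine norm_add_le_of_le ?_ ?_
          · rw [norm_mul, norm_one_sub]
            exact mul_le_mul_of_nonneg_left (norm_fiber_apply_le _ _ _ _) (sub_nonneg.mpr t.2.2)
          · rw [norm_mul, Complex.norm_of_nonneg t.2.1]
            exact mul_le_mul_of_nonneg_left (norm_fiber_apply_le _ _ _ _) t.2.1
      _ = ‖x‖ := by ring
  rw [bumpPath_eq_fiber_combination_model_sub, two_mul]
  exact norm_sub_le_of_le (norm_fiber_apply_le _ _ _ _) norm_interpolation_le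

end Model

section DenseGraph

variable {A B : Type*} [NormedRing A] [StarRing A] [ContinuousStar A] [NormedAlgebra ℂ A]
  [StarModule ℂ A] [NormedRing B] [StarRing B] [ContinuousStar B] [NormedAlgebra ℂ B]
  [StarModule ℂ B] [CompleteSpace B]

theorem exists_starAlgHom_of_dense_graph {Γ : StarSubalgebra ℂ (A × B)}
    (dense : DenseRange fun x : Γ => (x : A × B).1) {C : ℝ}
    (norm_le : ∀ x ∈ Γ, ‖x.2‖ ≤ C * ‖x.1‖) :
    ∃ π : A →⋆ₐ[ℂ] B, ∀ x ∈ Γ, π x.1 = x.2 := by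
  let fst : Γ →ₗ[ℂ] A := ((StarAlgHom.fst ℂ A B).comp Γ.subtype).toAlgHom.toLinearMap
  let snd : Γ →ₗ[ℂ] B := ((StarAlgHom.snd ℂ A B).comp Γ.subtype).toAlgHom.toLinearMap
  let L : A →L[ℂ] B := snd.extendOfNorm fst
  have L_fst (x : Γ) : L (x : A × B).1 = (x : A × B).2 :=
    LinearMap.extendOfNorm_eq (f := snd) (e := fst) dense ⟨C, fun x => norm_le x x.2⟩ x
  have L_one : L 1 = 1 := L_fst 1
  have L_mul (a b : A) : L (a * b) = L a * L b :=
    dense.induction_on₂ (isClosed_eq (by fun_prop) (by fun_prop))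
      (fun x y => by rw [L_fst x, L_fst y]; exact L_fst (x * y)) a b
  have L_star (a : A) : L (star a) = star (L a) :=
    dense.induction_on a (isClosed_eq (by fun_prop) (by fun_prop))
      (fun x => by rw [L_fst x]; exact L_fst (star x))
  exact ⟨{ toFun := L
           map_one' := L_one
           map_mul' := L_mul
           map_zero' := map_zero L
           map_add' := map_add L
           commutes' := fun c => by simp [Algebra.algebraMap_eq_smul_one, L_one]
           map_star' := L_star }, fun x hx => L_fst ⟨x, hx⟩⟩

end DenseGraph

section UniversalProperty

variable {n : ℕ} {B : Type*} [CStarAlgebra B]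

theorem eq_of_star_mul_self_eq_of_mul_eq {d x y : B} (hx : star x * x = d * d)
    (hy : star y * y = d * d) (h : x * d = y * d) : x = y := by
  have sub_mul_star {z : B} (hz : star z * z = d * d) : (x - y) * star z = 0 := by
    rw [← CStarRing.mul_star_self_eq_zero_iff, star_mul, star_star, mul_assoc, ← mul_assoc _ z, hz,
      ← mul_assoc, ← mul_assoc, sub_mul, h, sub_self, zero_mul, zero_mul]
  rw [← sub_eq_zero, ← CStarRing.mul_star_self_eq_zero_iff, star_sub, mul_sub, sub_mul_star hx,
    sub_mul_star hy, sub_zero]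

theorem starAlgHom_ext_of_map_model {φ ψ : dimDrop (Fin n) (Succ n) →⋆ₐ[ℂ] B}
    (h : (model n).map φ = (model n).map ψ) : φ = ψ := by
  have continuous (χ : dimDrop (Fin n) (Succ n) →⋆ₐ[ℂ] B) : Continuous χ :=
    AddMonoidHomClass.continuous_of_bound χ 1 fun f => by
      rw [one_mul]
      exact NonUnitalStarAlgHom.norm_apply_le χ f
  refine DFunLike.ext' <| denseRange_combination_model.equalizer (continuous φ)
    (continuous ψ) <| funext fun c => ?_
  rw [Function.comp_apply, ← WeightedUnits.map_combination, h, WeightedUnits.map_combination]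
  rfl

variable [PartialOrder B] [StarOrderedRing B]

theorem WeightedUnits.exists_norm_combination_le_mul_norm_model [NeZero n]
    {S : WeightedUnits n B} (hS : 0 ≤ S.ξ 1) :
    ∃ C, ∀ c, ‖S.combination c‖ ≤ C * ‖(model n).combination c‖ := by
  obtain ⟨C, hC⟩ := S.exists_norm_combination_le hS
  refine ⟨C * 2, fun c => ?_⟩
  rw [mul_assoc]
  refine hC c _ (fun i j => (norm_fst_apply_le c i j).trans ?_) (norm_snd_apply_le c)
    fun α β t => norm_bumpPath_apply_le c t α β
  linarith [norm_nonneg ((model n).combination c)]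

theorem WeightedUnits.exists_starAlgHom [NeZero n] {S : WeightedUnits n B} (hS : 0 ≤ S.ξ 1) :
    ∃ π : dimDrop (Fin n) (Succ n) →⋆ₐ[ℂ] B,
      (∀ a, π (embed a) = S.ξ a) ∧ ∀ b, π ((model n).H b) = S.H b := by
  obtain ⟨C, hC⟩ := S.exists_norm_combination_le_mul_norm_model hS
  set T := (model n).prod S
  have fst_combination (c) : (T.combination c).1 = (model n).combination c :=
    (T.map_combination (StarAlgHom.fst ℂ _ B) c).symm
  have snd_combination (c) : (T.combination c).2 = S.combination c :=
    (T.map_combination (StarAlgHom.snd ℂ _ B) c).symm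
  have dense : DenseRange fun x : T.starSubalgebra => (x : dimDrop (Fin n) (Succ n) × B).1 := by
    refine denseRange_combination_model.mono ?_
    rintro _ ⟨c, rfl⟩
    exact ⟨⟨T.combination c, WeightedUnits.combination_mem_span c⟩, fst_combination c⟩
  obtain ⟨π, hπ⟩ := exists_starAlgHom_of_dense_graph dense (C := C) fun x hx => by
    obtain ⟨c, rfl⟩ := WeightedUnits.exists_combination_eq_of_mem_span hx
    rw [fst_combination, snd_combination]
    exact hC c
  refine ⟨π, fun a => hπ (T.ξ a) (WeightedUnits.ξ_mem_span a), fun b => ?_⟩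
  calc π ((model n).H b) = π (T.H b).1 := congrArg π (T.map_H (StarAlgHom.fst ℂ _ B) b)
    _ = (T.H b).2 := hπ _ (WeightedUnits.H_mem_span b)
    _ = S.H b := (T.map_H (StarAlgHom.snd ℂ _ B) b).symm

theorem embed_rankOne_mul_corner {h : Fin n → ℂ} (hh : star h ⬝ᵥ h = 1) (x : Fin n → ℂ) :
    embed (rankOne x h) * corner h = corner x := by
  rw [embed_mul_corner]
  congr 1
  funext i
  simp only [rankOne_apply, mul_assoc, ← Finset.mul_sum]
  exact (congrArg (x i * ·) hh).trans (mul_one _)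

theorem absCorner_mul_absCorner : absCorner n * absCorner n = 1 - embed 1 :=
  (model n).Y_inr_mul_Y_inr

theorem map_absCorner_eq_sqrt (φ : dimDrop (Fin n) (Succ n) →⋆ₐ[ℂ] B) :
    φ (absCorner n) = CFC.sqrt (1 - φ (embed 1)) := by
  refine (CFC.sqrt_unique ?_ ?_).symm
  · rw [← map_mul, absCorner_mul_absCorner, map_sub, map_one]
  · obtain ⟨r, hr⟩ := exists_absCorner_eq_star_mul_self n
    rw [hr, map_mul, map_star]
    exact star_mul_self_nonneg _

theorem starAlgHom_ext {h : Fin n → ℂ} (hh : star h ⬝ᵥ h = 1)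
    {φ ψ : dimDrop (Fin n) (Succ n) →⋆ₐ[ℂ] B} (embed_eq : ∀ a, φ (embed a) = ψ (embed a))
    (corner_eq : φ (corner h) = ψ (corner h)) : φ = ψ := by
  refine starAlgHom_ext_of_map_model (WeightedUnits.ext ?_ ?_)
  · exact LinearMap.ext embed_eq
  · funext k
    rcases k with i | i
    · change φ (corner _) = ψ (corner _)
      rw [← embed_rankOne_mul_corner hh, map_mul, map_mul, embed_eq, corner_eq]
    · change φ (absCorner n) = ψ (absCorner n)
      rw [map_absCorner_eq_sqrt, map_absCorner_eq_sqrt, embed_eq]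

theorem WeightedUnits.exists_map_model_eq [NeZero n] {S : WeightedUnits n B} (hξ : 0 ≤ S.ξ 1)
    (hY : 0 ≤ S.Y (Sum.inr 0)) :
    ∃ π : dimDrop (Fin n) (Succ n) →⋆ₐ[ℂ] B, (model n).map π = S := by
  obtain ⟨π, map_embed, map_H⟩ := S.exists_starAlgHom hξ
  have map_absCorner : π (absCorner n) = S.Y (Sum.inr 0) := by
    rw [map_absCorner_eq_sqrt, map_embed, ← S.Y_inr_mul_Y_inr, CFC.sqrt_mul_self _ hY]
  refine ⟨π, WeightedUnits.ext (LinearMap.ext map_embed) (funext fun k => ?_)⟩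
  rcases k with i | i
  · refine eq_of_star_mul_self_eq_of_mul_eq (d := S.Y (Sum.inr 0)) ?_ ?_ ?_
    · rw [star_Y_mul_Y, if_pos rfl, map_ξ, S.Y_inr_mul_Y_inr]
      exact congrArg (1 - ·) (map_embed 1)
    · rw [star_Y_mul_Y, if_pos rfl, S.Y_inr_mul_Y_inr]
    · have := map_H (matrixUnit (Sum.inl i) (Sum.inr 0))
      simp only [H_apply, sandwich_matrixUnit, star_Y_inr, mul_one, map_mul] at this
      rwa [← map_absCorner] at this ⊢
  · rw [Subsingleton.elim i 0]
    exact map_absCorner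

end UniversalProperty

section OrderZero

variable {n : ℕ} {B : Type*} [CStarAlgebra B] [PartialOrder B] [StarOrderedRing B]

theorem sqrt_one_sub_mul_eq_zero {c s : B} (hc : c ≤ 1) (hs : c * s = s) :
    CFC.sqrt (1 - c) * s = 0 := by
  rw [← CStarRing.star_mul_self_eq_zero_iff, star_mul,
    (IsSelfAdjoint.of_nonneg (CFC.sqrt_nonneg (1 - c))).star_eq, mul_assoc, ← mul_assoc _ _ s,
    CFC.sqrt_mul_sqrt_self _ (sub_nonneg.mpr hc), sub_mul, one_mul, hs, sub_self, mul_zero]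

namespace IsOrderZero

variable {ξ : CompletelyPositiveMap (Mat (Fin n)) B} (hξ : IsOrderZero ξ)
include hξ

theorem commute_map_sqrt_one_sub (a : Mat (Fin n)) : Commute (ξ a) (CFC.sqrt (1 - ξ 1)) := by
  have commute_one : Commute (ξ 1) (ξ a) := by rw [commute_iff_eq, hξ.map_mul_map a 1, mul_one]
  rw [CFC.sqrt_eq_cfc]
  exact (((Commute.one_left _).sub_left commute_one).cfc_nnreal _).symm

theorem map_one_mul_of_map_mul_eq {p : Mat (Fin n)} (hp : IsIdempotentElem p) {s : B}
    (hs : ξ p * s = s) : ξ 1 * s = s :=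
  calc ξ 1 * s = ξ 1 * ξ (p * p) * s := by rw [hp.eq, mul_assoc, hs]
    _ = s := by rw [← hξ.map_mul_map, mul_assoc, hs, hs]

theorem map_mul_map_mul {s : B} (hs : ξ 1 * s = s) (a b : Mat (Fin n)) :
    ξ a * (ξ b * s) = ξ (a * b) * s := by
  conv_rhs => rw [← hs, ← mul_assoc, hξ.map_mul_map, mul_one]
  rw [← mul_assoc, hξ.map_mul_map]

theorem sqrt_one_sub_mul_map_mul_eq_zero {s : B} (hξ_one : ξ 1 ≤ 1) (hs : ξ 1 * s = s)
    (a : Mat (Fin n)) : CFC.sqrt (1 - ξ 1) * (ξ a * s) = 0 := by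
  rw [← mul_assoc, ← hξ.commute_map_sqrt_one_sub, mul_assoc, sqrt_one_sub_mul_eq_zero hξ_one hs,
    mul_zero]

theorem star_map_rankOne_mul_mul_map_rankOne_mul {h : Fin n → ℂ} (hh : star h ⬝ᵥ h = 1) {s : B}
    (hs : ξ (rankOne h h) * s = s) (x y : Fin n → ℂ) :
    star (ξ (rankOne x h) * s) * (ξ (rankOne y h) * s) = (star x ⬝ᵥ y) • (star s * s) := by
  have map_one_mul := hξ.map_one_mul_of_map_mul_eq (isIdempotentElem_rankOne_self hh) hs
  rw [star_mul, ← completelyPositiveMap_star, star_rankOne, mul_assoc,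
    hξ.map_mul_map_mul map_one_mul, rankOne_mul_rankOne, map_smul, smul_mul_assoc, hs,
    mul_smul_comm]

theorem exists_weightedUnits {h : Fin n → ℂ} (hh : star h ⬝ᵥ h = 1) {s : B}
    (hs : ξ (rankOne h h) * s = s) (hsum : ξ 1 + star s * s = 1) :
    ∃ S : WeightedUnits n B, (∀ a, S.ξ a = ξ a) ∧ 0 ≤ S.Y (Sum.inr 0) ∧
      ∑ i, h i • S.Y (Sum.inl i) = s := by
  have star_s_mul_s : star s * s = 1 - ξ 1 := eq_sub_of_add_eq' hsum
  have map_one_le : ξ 1 ≤ 1 := sub_nonneg.mp (star_s_mul_s ▸ star_mul_self_nonneg s)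
  have map_one_mul := hξ.map_one_mul_of_map_mul_eq (isIdempotentElem_rankOne_self hh) hs
  set d := CFC.sqrt (1 - ξ 1)
  have star_d : star d = d := (IsSelfAdjoint.of_nonneg (CFC.sqrt_nonneg _)).star_eq
  have d_mul_d : d * d = 1 - ξ 1 := CFC.sqrt_mul_sqrt_self _ (sub_nonneg.mpr map_one_le)
  have d_mul_column (a : Mat (Fin n)) : d * (ξ a * s) = 0 :=
    hξ.sqrt_one_sub_mul_map_mul_eq_zero map_one_le map_one_mul a
  refine ⟨{
    ξ := ξ.toLinearMap
    Y := Sum.elim (fun i => ξ (rankOne (Pi.single i 1) h) * s) fun _ => d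
    star_ξ a := (completelyPositiveMap_star ξ a).symm
    ξ_mul_ξ := hξ.map_mul_map
    star_Y_mul_Y := ?_
    ξ_mul_Y_inl a j := ?_
    ξ_mul_Y_inr a _ := hξ.commute_map_sqrt_one_sub a
    star_Y_inr _ := star_d }, fun _ => rfl, CFC.sqrt_nonneg _, ?_⟩
  · rintro (i | i) (j | j)
    · simp only [Sum.elim_inl, hξ.star_map_rankOne_mul_mul_map_rankOne_mul hh hs, star_s_mul_s]
      simp only [Pi.star_single, star_one, single_one_dotProduct, Pi.single_apply, ite_smul,
        one_smul, zero_smul, Sum.inl.injEq]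
      rfl
    · have := congrArg star (d_mul_column (rankOne (Pi.single i 1) h))
      simpa [star_mul, star_d] using this
    · simpa [star_d] using d_mul_column (rankOne (Pi.single j 1) h)
    · rw [Subsingleton.elim i j, if_pos rfl]
      exact (congrArg (· * d) star_d).trans d_mul_d
  · change ξ a * (ξ _ * s) = ∑ i, a i j • (ξ _ * s)
    rw [hξ.map_mul_map_mul map_one_mul, mul_rankOne, rankOne_eq_sum_single, map_sum,
      Finset.sum_mul]
    simp [Pi.single_apply]
  · change ∑ i, h i • (ξ _ * s) = s
    simp only [← smul_mul_assoc, ← map_smul, ← Finset.sum_mul, ← map_sum]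
    rw [← rankOne_eq_sum_single, hs]

theorem exists_starAlgHom {h : Fin n → ℂ} (hh : star h ⬝ᵥ h = 1) {s : B}
    (hs : ξ (rankOne h h) * s = s) (hsum : ξ 1 + star s * s = 1) :
    ∃ π : dimDrop (Fin n) (Succ n) →⋆ₐ[ℂ] B, (∀ a, π (embed a) = ξ a) ∧ π (corner h) = s := by
  obtain ⟨S, S_ξ, Y_inr_nonneg, sum_Y⟩ := hξ.exists_weightedUnits hh hs hsum
  have : NeZero n := ⟨by rintro rfl; simp at hh⟩
  have S_ξ_one_nonneg : 0 ≤ S.ξ 1 := (S_ξ 1).symm ▸ map_nonneg ξ zero_le_one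
  obtain ⟨π, rfl⟩ := WeightedUnits.exists_map_model_eq S_ξ_one_nonneg Y_inr_nonneg
  refine ⟨π, S_ξ, ?_⟩
  rw [corner_eq_sum_single, ← sum_Y, map_sum]
  simp only [map_smul]
  rfl

end IsOrderZero

end OrderZero

section Representations

variable {ι κ G : Type*} [Fintype ι] [DecidableEq ι] [Fintype κ] [DecidableEq κ] [Group G]
  (v : G →* unitary (Mat ι)) (w : G →* unitary (Mat κ)) (g : G)

theorem coe_sumRep : (sumRep v w g : Mat (ι ⊕ κ)) = directSum (v g : Mat ι) (w g : Mat κ) := rfl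

theorem coe_tensorRep : (tensorRep v w g : Mat (ι × κ)) = kron (v g : Mat ι) (w g : Mat κ) := rfl

theorem Ad_sumRep_directSum (a : Mat ι) (b : Mat κ) :
    Ad (sumRep v w) g (directSum a b) = directSum (Ad v g a) (Ad w g b) := by
  simp only [Ad_apply, coe_sumRep, directSum_star, directSum_mul]

end Representations

section Equivariance

variable {n : ℕ}

theorem flip_mul_kron_directSum (w : Mat (Fin n)) :
    flip n * kron w (directSum w 1) = kron w (directSum w 1) * flip n := by
  ext ⟨i, j⟩ ⟨k, l⟩
  rw [flip_mul, mul_flip]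
  rcases j with j | j <;> rcases l with l | l <;>
    simp [kron_apply, directSum, mul_comm, Fin.fin_one_eq_zero]

theorem fiberEquiv_kron_directSum (t : unitInterval) (w : Mat (Fin n)) :
    fiberEquiv t (kron w (directSum w 1)) = kron (directSum w 1) w := by
  have flipPath_mul : flipPath n t * kron w (directSum w 1) =
      kron w (directSum w 1) * flipPath n t := by
    simp only [flipPath, add_mul, mul_add, smul_mul_assoc, mul_smul_comm, one_mul, mul_one,
      flip_mul_kron_directSum]
  ext ⟨i, j⟩ ⟨k, l⟩
  rw [fiberEquiv_apply, flipPath_mul, mul_assoc, flipPath_mul_star_flipPath, mul_one]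
  rcases i with i | i <;> rcases k with k | k <;>
    simp [swapEquiv, kron_apply, directSum, Fin.fin_one_eq_zero, mul_comm]

variable {G : Type*} [Group G] (v : G →* unitary (Mat (Fin n))) (g : G)

theorem fiber_dimDropAction (f : dimDrop (Fin n) (Succ n)) (t : unitInterval) :
    fiber n t (dimDropAction v (sumRep v 1) g f) =
      Ad (tensorRep (sumRep v 1) v) g (fiber n t f) := by
  have action : (dimDropAction v (sumRep v 1) g f : C(unitInterval, Mat (Fin n × Succ n))) t =
      Ad (tensorRep v (sumRep v 1)) g ((f : C(unitInterval, Mat (Fin n × Succ n))) t) := rfl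
  rw [fiber_apply, fiber_apply, action, Ad_apply, Ad_apply, coe_tensorRep, coe_tensorRep,
    coe_sumRep, MonoidHom.one_apply, OneMemClass.coe_one, map_mul, map_mul, map_star,
    fiberEquiv_kron_directSum]

theorem Ad_sumRep_lastCol {h : Fin n → ℂ} :
    Ad (sumRep v (1 : G →* unitary (Mat (Fin 1)))) g (lastCol h) =
      lastCol fun i => ∑ j, (v g : Mat (Fin n)) i j * h j := by
  rw [Ad_apply, coe_sumRep, directSum_star]
  ext (i | i) (j | j) <;> simp [directSum, lastCol, CStarMatrix.mul_apply, Fin.fin_one_eq_zero]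

theorem dimDropAction_embed (x : Mat (Fin n)) :
    dimDropAction v (sumRep v 1) g (embed x) = embed (Ad v g x) := by
  refine fiber_ext fun t => ?_
  rw [fiber_dimDropAction, fiber_embed, fiber_embed, map_add, map_smul, Ad_tensorRep, Ad_tensorRep,
    lastProj, Ad_sumRep_directSum, Ad_sumRep_directSum, map_one, map_one, map_zero, map_zero]

theorem dimDropAction_corner (h : Fin n → ℂ) :
    dimDropAction v (sumRep v 1) g (corner h) =
      corner fun i => ∑ j, (v g : Mat (Fin n)) i j * h j := by
  refine fiber_ext fun t => ?_
  rw [fiber_dimDropAction, fiber_corner, fiber_corner, map_smul, Ad_tensorRep, Ad_sumRep_lastCol,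
    map_one]

theorem dimDropAction_corner_of_fixed {h : Fin n → ℂ} (hh : star h ⬝ᵥ h = 1)
    (hv : (v g : Mat (Fin n)) * rankOne h h = rankOne h h) :
    dimDropAction v (sumRep v 1) g (corner h) = corner h := by
  have h_ne_zero : h ≠ 0 := by
    rintro rfl
    simp at hh
  rw [dimDropAction_corner]
  rw [mul_rankOne] at hv
  exact congrArg corner (rankOne_left_injective h_ne_zero hv)

end Equivariance

end DimDrop

theorem mainTheorem8_general {G : Type*} [Group G]
    {B : Type*} [CStarAlgebra B] [PartialOrder B] [StarOrderedRing B]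
    (β : G →* (B ≃⋆ₐ[ℂ] B)) (n : ℕ)
    (v : G →* unitary (DimDrop.Mat (Fin n)))
    (e : DimDrop.Mat (Fin n)) (he : IsStarProjection e)
    (he_rank : (CStarMatrix.ofMatrix.symm e).rank = 1)
    (he_fix : ∀ g, (v g : DimDrop.Mat (Fin n)) * e = e)
    (ξ : CompletelyPositiveMap (DimDrop.Mat (Fin n)) B)
    (hξ_zero : DimDrop.IsOrderZero ξ)
    (hξ_equiv : ∀ g x, ξ (DimDrop.Ad v g x) = β g (ξ x))
    (s : B) (hs_fix : ∀ g, β g s = s)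
    (hs_left : ξ e * s = s) (hs_sum : ξ 1 + star s * s = 1) :
    ∃ π : DimDrop.dimDrop (Fin n) (DimDrop.Succ n) →⋆ₐ[ℂ] B,
      (∀ g f, π (DimDrop.dimDropAction v (DimDrop.sumRep v 1) g f) = β g (π f)) ∧
      (∀ x, π (DimDrop.embed x) = ξ x) ∧
      ∃ h : Fin n → ℂ, (∀ i j, e i j = h i * star (h j)) ∧ π (DimDrop.corner h) = s := by
  obtain ⟨h, hh, rfl⟩ := DimDrop.exists_eq_rankOne_self he he_rank
  obtain ⟨π, π_embed, π_corner⟩ := hξ_zero.exists_starAlgHom hh hs_left hs_sum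
  refine ⟨π, fun g f => ?_, π_embed, h, fun _ _ => rfl, π_corner⟩
  suffices π.comp (DimDrop.dimDropAction v (DimDrop.sumRep v 1) g).toStarAlgHom =
      (β g).toStarAlgHom.comp π from DFunLike.congr_fun this f
  refine DimDrop.starAlgHom_ext hh (fun a => ?_) ?_
  · change π (DimDrop.dimDropAction v _ g (DimDrop.embed a)) = β g (π (DimDrop.embed a))
    rw [DimDrop.dimDropAction_embed, π_embed, π_embed, hξ_equiv]
  · change π (DimDrop.dimDropAction v _ g (DimDrop.corner h)) = β g (π (DimDrop.corner h))
    rw [DimDrop.dimDropAction_corner_of_fixed v g hh (he_fix g), π_corner, hs_fix]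

theorem mainTheorem8 {G : Type*} [Group G] [Finite G]
    {B : Type*} [CStarAlgebra B] [PartialOrder B] [StarOrderedRing B]
    (β : G →* (B ≃⋆ₐ[ℂ] B)) (n : ℕ)
    (v : G →* unitary (DimDrop.Mat (Fin n)))
    (e : DimDrop.Mat (Fin n)) (he : IsStarProjection e)
    (he_rank : (CStarMatrix.ofMatrix.symm e).rank = 1)
    (he_fix : ∀ g, (v g : DimDrop.Mat (Fin n)) * e = e)
    (ξ : CompletelyPositiveMap (DimDrop.Mat (Fin n)) B)
    (hξ_contr : ∀ x, ‖ξ x‖ ≤ ‖x‖)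
    (hξ_zero : DimDrop.IsOrderZero ξ)
    (hξ_equiv : ∀ g x, ξ (DimDrop.Ad v g x) = β g (ξ x))
    (s : B) (hs_contr : ‖s‖ ≤ 1) (hs_fix : ∀ g, β g s = s)
    (hs_left : ξ e * s = s) (hs_sum : ξ 1 + star s * s = 1) :
    ∃ π : DimDrop.dimDrop (Fin n) (DimDrop.Succ n) →⋆ₐ[ℂ] B,
      (∀ g f, π (DimDrop.dimDropAction v (DimDrop.sumRep v 1) g f) = β g (π f)) ∧
      (∀ x, π (DimDrop.embed x) = ξ x) ∧
      ∃ h : Fin n → ℂ, (∀ i j, e i j = h i * star (h j)) ∧ π (DimDrop.corner h) = s :=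
  mainTheorem8_general β n v e he he_rank he_fix ξ hξ_zero hξ_equiv s hs_fix hs_left hs_sum
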